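/- Let $G=(V_G,E_G)$ be a finite connected simple graph with at least two vertices, and let $d$ be its maximum degree. The Lamplighter chain on $G$ is the continuous-time Markov chain on $V_G\times\{0,1\}^{V_G}$ with generator $$(Qf)(i,\sigma)=\tfrac12\bigl(f(i,\sigma^i)-f(i,\sigma)\bigr)+\frac{1}{2\deg(i)}\sum_{j\sim i}\bigl(f(j,\sigma)-f(i,\sigma)\bigr),$$ where $\sigma^i$ is obtained from $\sigma$ by replacing $\sigma_i$ with $1-\sigma_i$. It is irreducible, and reversible with respect to $\pi(i,\sigma)=\frac{\deg(i)}{\sum_j\deg(j)}2^{-|V_G|}$. For a finite irreducible chain with generator $Q$, reversible with respect to $\pi$, let ${\rm t}_{\rm mls}$ be its modified log-Sobolev constant, i.e. the smallest $t\ge 0$ such that $\mathrm{Ent}(f)\le t\,\mathcal E(f,\log f)$ for all $f>0$, where $\mathrm{Ent}(f)=\mathbf E_\pi[f\log f]-\mathbf E_\pi[f]\log\mathbf E_\pi[f]$ and $\mathcal E(f,g)=\frac12\sum_{x,y}\pi(x)Q(x,y)(f(x)-f(y))(g(x)-g(y))$. Let $\gamma(G)$ be the spectral gap of the simple random walk on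 $G$ (with transition matrix $P$), i.e. the second smallest eigenvalue, counted with multiplicity, of $I-P$; it is positive. (i) For every $d$ there are constants $c_d,C_d>0$, depending only on $d$, such that for every such graph $G$ of maximum degree $d$, the Lamplighter chain on $G$ satisfies $$c_d\,\frac{|V_G|}{\gamma(G)}\ \le\ {\rm t}_{\rm mls}\ \le\ C_d\,\frac{|V_G|}{\gamma(G)}.$$ (ii) For $\varepsilon>0$ let ${\rm t}_{\rm mix}(\varepsilon)$ and ${\rm t}_{\rm ent}(\varepsilon)$ be the smallest times $t\ge0$ at which, for every starting state $x$, the law $P_t(x,\cdot)$, with $P_t=e^{tQ}$, is within $\varepsilon$ of $\pi$ in total variation distance, respectively in relative entropy $D(P_t(x,\cdot)\,\|\,\pi)$. For every dimension $k\ge1$, every $\varepsilon>0$ and every real $c$, the Lamplighter chains on the discrete tori $(\mathbb Z/n\mathbb Z)^k$ satisfy ${\rm t}_{\rm mls}>c\,{\rm t}_{\rm mix}(\varepsilon)$ and ${\rm t}_{\rm mls}>c\,{\rm t}_{\rm ent}(\varepsilon)$ for all sufficiently large $n$. In particular, there is no universal constant $c$ with ${\rm t}_{\rm mls}\le c\,{\rm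 t}_{\rm mix}$ for all irreducible Markov chains (negative answer to Question 8.2 of Montenegro and Tetali), nor one with ${\rm t}_{\rm mls}\le c\,{\rm t}_{\rm ent}$ (negative answer to Question 7.1 of Hermon and Peres). -/

import Mathlib

noncomputable section

namespace MarkovChain

variable {X : Type*} [Fintype X]

/-- `Q` is an irreducible Markov generator (with off-diagonal entries the jump rates) on the finite
set `X`, reversible with respect to the probability vector `π`. -/
structure IsIrreducibleReversible (Q : Matrix X X ℝ) (π : X → ℝ) : Prop where
  rate_nonneg : ∀ x y, x ≠ y → 0 ≤ Q x y
  row_sum : ∀ x, ∑ y, Q x y = 0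
  irreducible : ∀ x y, Relation.ReflTransGen (fun a b => 0 < Q a b) x y
  prob_nonneg : ∀ x, 0 ≤ π x
  prob_sum : ∑ x, π x = 1
  reversible : ∀ x y, π x * Q x y = π y * Q y x

/-- Expectation with respect to `π`. -/
def expect (π : X → ℝ) (f : X → ℝ) : ℝ := ∑ x, π x * f x

/-- The Dirichlet form `ℰ(f, g)`. -/
def dirichletForm (Q : Matrix X X ℝ) (π : X → ℝ) (f g : X → ℝ) : ℝ :=
  (1 / 2) * ∑ x, ∑ y, π x * Q x y * (f x - f y) * (g x - g y)

/-- The entropy `Ent(f) = E[f log f] - E[f] log E[f]`. -/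
def ent (π : X → ℝ) (f : X → ℝ) : ℝ :=
  expect π (fun x => f x * Real.log (f x)) - expect π f * Real.log (expect π f)

/-- The modified log-Sobolev constant: the optimal `t` in `Ent(f) ≤ t ℰ(f, log f)` for all
`f : X → (0, ∞)`. -/
def tMLS (Q : Matrix X X ℝ) (π : X → ℝ) : ℝ :=
  sInf {t : ℝ | 0 ≤ t ∧ ∀ f : X → ℝ, (∀ x, 0 < f x) →
    ent π f ≤ t * dirichletForm Q π f (fun x => Real.log (f x))}

/-- The spectral gap: the smallest eigenvalue of `-Q` on the space of functions of mean zero. -/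
def spectralGap (Q : Matrix X X ℝ) (π : X → ℝ) : ℝ :=
  sInf {l : ℝ | ∃ f : X → ℝ, f ≠ 0 ∧ expect π f = 0 ∧ -(Q.mulVec f) = l • f}

/-- The matrix of an operator on functions: `(L f)(x) = ∑ y, (toMatrix L) x y * f y` when `L` is
linear. -/
def toMatrix [DecidableEq X] (L : (X → ℝ) → (X → ℝ)) : Matrix X X ℝ :=
  Matrix.of fun x y => L (Pi.single y 1) x

/-- The transition matrix `P_t = exp(tQ)` of the continuous-time chain. -/
def transition [DecidableEq X] (Q : Matrix X X ℝ) (t : ℝ) : Matrix X X ℝ :=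
  NormedSpace.exp (t • Q)

/-- Total variation distance. -/
def tvDist (μ π : X → ℝ) : ℝ := (1 / 2) * ∑ y, |μ y - π y|

/-- Relative entropy `D(μ ‖ π)`. -/
def relEntropy (μ π : X → ℝ) : ℝ := ∑ y, μ y * Real.log (μ y / π y)

/-- The total-variation mixing time with threshold `ε`. -/
def tMix [DecidableEq X] (Q : Matrix X X ℝ) (π : X → ℝ) (ε : ℝ) : ℝ :=
  sInf {t : ℝ | 0 ≤ t ∧ ∀ x, tvDist (transition Q t x) π ≤ ε}

/-- The relative-entropy mixing time with threshold `ε`. -/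
def tEnt [DecidableEq X] (Q : Matrix X X ℝ) (π : X → ℝ) (ε : ℝ) : ℝ :=
  sInf {t : ℝ | 0 ≤ t ∧ ∀ x, relEntropy (transition Q t x) π ≤ ε}

end MarkovChain

namespace Lamplighter

open MarkovChain

variable {V : Type*} [Fintype V] [DecidableEq V] (G : SimpleGraph V) [DecidableRel G.Adj]

/-- The generator of simple random walk on `G` (jumps at rate one to a uniform neighbour). -/
def walkGen : Matrix V V ℝ :=
  toMatrix fun f i => (1 / (G.degree i : ℝ)) * ∑ j ∈ G.neighborFinset i, (f j - f i)

/-- The reversible law of simple random walk, proportional to the degree. -/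
def walkLaw : V → ℝ := fun i => (G.degree i : ℝ) / ∑ j, (G.degree j : ℝ)

/-- The spectral gap `γ(G)` of the graph `G`. -/
def gap : ℝ := spectralGap (walkGen G) (walkLaw G)

/-- The configuration `σ^i`: the lamp at `i` is switched. -/
def flip (σ : V → Bool) (i : V) : V → Bool := Function.update σ i (!σ i)

/-- The generator of the Lamplighter chain on `G`, on the state space `V × {0,1}^V`. -/
def lampGen : Matrix (V × (V → Bool)) (V × (V → Bool)) ℝ :=
  toMatrix fun f x =>
    (1 / 2) * (f (x.1, flip x.2 x.1) - f (x.1, x.2)) +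
      (1 / (2 * (G.degree x.1 : ℝ))) * ∑ j ∈ G.neighborFinset x.1, (f (j, x.2) - f (x.1, x.2))

/-- The reversible law of the Lamplighter chain: the lamplighter's position has the reversible law
of the walk, and the lamps are independent fair coins. -/
def lampLaw : V × (V → Bool) → ℝ := fun x => walkLaw G x.1 * (1 / 2) ^ Fintype.card V

/-- The `k`-dimensional discrete torus `(ℤ/nℤ)^k` (meant for `n ≥ 3`): `x` and `y` are adjacent if
they differ by `±1` in exactly one coordinate. -/
def torus (k n : ℕ) : SimpleGraph (Fin k → ZMod n) :=
  SimpleGraph.circulantGraph (Set.range fun i : Fin k => (Pi.single i 1 : Fin k → ZMod n))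

instance (k n : ℕ) : DecidableRel (torus k n).Adj := Classical.decRel _

end Lamplighter

end

/-!
The modified log-Sobolev constant of the lamplighter chain is of order `|V| / γ(G)` for bounded
degrees, and this exceeds its mixing times on large tori.

*Upper bound.* With `g = √f`, it suffices to bound `Ent(f)` by `ℰ(g, g)`. Split `Ent(f)` into the
entropy of the position given the lamps and the entropy of the lamps' marginal `F`. The former is
at most a multiple of `|V|` times a variance (`ent_sq_le`), hence of `|V| / γ` times the Dirichlet
form of the walk. The latter is at most `∑ x, E (√F(σ) - √F(σˣ))²` (`ent_coin_le_of_invariant`). Both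
`√F(σ)` and `√F(σˣ)` are compared with `g(x, ·)`, at the position `x` where the lamp `x` can be
flipped; since all the `x` are summed, the comparison costs a single position variance, and not one
per lamp (`ent_lamp_le`).

*Lower bound.* Let `h` be the positive part of a gap eigenfunction, with sign chosen so that the
zero set `A` of `h` has at least `|V| / 2` vertices. The density `h(i)² 1{σ = 0 on A}`, once
normalised, has entropy of order `|A|` and costs nothing in flips, as the lamplighter never stands on `A`. The resolvent of the
chain turns it into a positive density whose ratios along jumps are bounded, so that `ℰ(f, log f)`
is comparable with `ℰ(√f, √f)`, at most of order `γ` (`exists_regularised`), while only a few lamps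
of `A` get lit; the Gibbs variational principle then keeps the entropy of order `|V|`
(`card_div_gap_le`).

*Mixing.* A flip at rate `1/2` is a refresh at rate `1`, so the chain is the image of one that records
the set of lamps not yet refreshed. Convexity bounds the relative entropy at time `t` by that of
the position plus the expected size of this set. Both decay exponentially at a rate of order `1 / R`,
where `R` bounds `(v y - v x)² / ℰ(v, v)` on the graph (`relEntropy_transition_le`). On `(ℤ/nℤ)^k`
a path argument gives `R` of order `n^(k+1)` (`torus_resistance`), so that times of order
`n^(k+1) √n` suffice, whereas `γ` is at most of order `n⁻²` (`torus_gap_le`) and the modified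
log-Sobolev constant is therefore at least of order `n^(k+2)`.
-/

set_option linter.unusedSectionVars false

open scoped Matrix

namespace MarkovChain

/-! ### Reversible chains: Dirichlet form and stationarity -/

section General

variable {X : Type*} [Fintype X]

/-- The matrix attached to a linear operator on functions represents that operator. -/
lemma sum_toMatrix_mul [DecidableEq X] (L : (X → ℝ) → X → ℝ) (hL : IsLinearMap ℝ L)
    (f : X → ℝ) (x : X) : ∑ y, toMatrix L x y * f y = L f x := by
  have h : f = ∑ y, f y • (Pi.single y (1 : ℝ) : X → ℝ) := by
    ext z
    simp [Finset.sum_apply, Pi.single_apply]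
  have h2 : L f = ∑ y, f y • L (Pi.single y (1 : ℝ)) := by
    conv_lhs => rw [h]
    change (hL.mk' L) _ = _
    rw [map_sum]
    simp only [map_smul]
    rfl
  rw [h2, Finset.sum_apply]
  exact Finset.sum_congr rfl fun y _ => by simp [toMatrix, mul_comm]

lemma expect_add (π f g : X → ℝ) : expect π (fun x => f x + g x) = expect π f + expect π g := by
  simp [expect, mul_add, Finset.sum_add_distrib]

lemma expect_sub (π f g : X → ℝ) : expect π (fun x => f x - g x) = expect π f - expect π g := by
  simp [expect, mul_sub, Finset.sum_sub_distrib]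

lemma expect_smul (π : X → ℝ) (c : ℝ) (f : X → ℝ) :
    expect π (fun x => c * f x) = c * expect π f := by
  simp only [expect, Finset.mul_sum]
  exact Finset.sum_congr rfl fun x _ => by ring

lemma expect_mono {π f g : X → ℝ} (hπ : ∀ x, 0 ≤ π x) (h : ∀ x, f x ≤ g x) :
    expect π f ≤ expect π g :=
  Finset.sum_le_sum fun x _ => mul_le_mul_of_nonneg_left (h x) (hπ x)

lemma expect_nonneg {π f : X → ℝ} (hπ : ∀ x, 0 ≤ π x) (h : ∀ x, 0 ≤ f x) : 0 ≤ expect π f :=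
  Finset.sum_nonneg fun x _ => mul_nonneg (hπ x) (h x)

lemma expect_const {π : X → ℝ} (h : ∑ x, π x = 1) (c : ℝ) : expect π (fun _ => c) = c := by
  simp [expect, ← Finset.sum_mul, h]

/-- A nonnegative function with zero mean vanishes. -/
lemma eq_zero_of_expect_eq_zero {π f : X → ℝ} (hπ : ∀ x, 0 < π x) (hf : ∀ x, 0 ≤ f x)
    (h : expect π f = 0) (x : X) : f x = 0 := by
  have := (Finset.sum_eq_zero_iff_of_nonneg (fun x _ => mul_nonneg (hπ x).le (hf x))).1 h x
    (Finset.mem_univ x)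
  exact (mul_eq_zero.1 this).resolve_left (hπ x).ne'

/-- Variance identity. -/
lemma expect_sub_sq {π : X → ℝ} (h : ∑ x, π x = 1) (f : X → ℝ) (c : ℝ) :
    expect π (fun x => (f x - c) ^ 2) =
      expect π (fun x => f x ^ 2) - 2 * c * expect π f + c ^ 2 := by
  have : ∀ x, (f x - c) ^ 2 = (f x ^ 2 - (2 * c) * f x) + c ^ 2 := fun x => by ring
  simp only [this]
  rw [expect_add, expect_sub, expect_smul, expect_const h]

lemma sq_expect_le {π : X → ℝ} (hπ : ∀ x, 0 ≤ π x) (h : ∑ x, π x = 1) (f : X → ℝ) :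
    expect π f ^ 2 ≤ expect π (fun x => f x ^ 2) := by
  have h1 := expect_sub_sq h f (expect π f)
  have h2 : 0 ≤ expect π (fun x => (f x - expect π f) ^ 2) :=
    expect_nonneg hπ fun x => sq_nonneg _
  nlinarith

/-- Polarised Dirichlet form: `ℰ(f, g) = -⟨f, Q g⟩_π`. -/
lemma dirichletForm_eq {Q : Matrix X X ℝ} {π : X → ℝ} (hrow : ∀ x, ∑ y, Q x y = 0)
    (hrev : ∀ x y, π x * Q x y = π y * Q y x) (f g : X → ℝ) :
    dirichletForm Q π f g = -expect π (fun x => f x * ∑ y, Q x y * g y) := by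
  have e : ∀ x y, π x * Q x y * (f x - f y) * (g x - g y) =
      π x * f x * g x * Q x y - π x * f x * (Q x y * g y)
        - π y * f y * (Q y x * g x) + π y * f y * g y * Q y x := by
    intro x y
    linear_combination (f y * g y - f y * g x) * hrev x y
  have s1 : ∑ x, ∑ y, π x * f x * g x * Q x y = 0 := by
    simp [← Finset.mul_sum, hrow]
  have s2 : ∑ x, ∑ y, π y * f y * g y * Q y x = 0 := by
    rw [Finset.sum_comm]; exact s1
  have s3 : ∑ x, ∑ y, π y * f y * (Q y x * g x) = ∑ x, ∑ y, π x * f x * (Q x y * g y) :=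
    Finset.sum_comm
  have s4 : ∑ x, ∑ y, π x * f x * (Q x y * g y) =
      expect π (fun x => f x * ∑ y, Q x y * g y) := by
    simp only [expect, Finset.mul_sum, mul_assoc]
  rw [dirichletForm]
  simp only [e, Finset.sum_add_distrib, Finset.sum_sub_distrib, s1, s2, s3, s4]
  ring

lemma dirichletForm_comm (Q : Matrix X X ℝ) (π f g : X → ℝ) :
    dirichletForm Q π f g = dirichletForm Q π g f := by
  simp only [dirichletForm]
  congr 1
  exact Finset.sum_congr rfl fun x _ => Finset.sum_congr rfl fun y _ => by ring

/-- Pointwise comparison of Dirichlet forms: only the nonnegative off-diagonal rates matter. -/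
lemma dirichletForm_mono {Q : Matrix X X ℝ} {π : X → ℝ} (hQ : ∀ x y, x ≠ y → 0 ≤ Q x y)
    (hπ : ∀ x, 0 ≤ π x) {f g f' g' : X → ℝ}
    (h : ∀ x y, 0 < Q x y → (f x - f y) * (g x - g y) ≤ (f' x - f' y) * (g' x - g' y)) :
    dirichletForm Q π f g ≤ dirichletForm Q π f' g' := by
  refine mul_le_mul_of_nonneg_left ?_ (by norm_num)
  refine Finset.sum_le_sum fun x _ => Finset.sum_le_sum fun y _ => ?_
  rw [mul_assoc, mul_assoc (π x * Q x y)]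
  rcases eq_or_ne x y with rfl | hxy
  · simp
  · rcases (hQ x y hxy).eq_or_lt with h0 | h0
    · simp [← h0]
    · exact mul_le_mul_of_nonneg_left (h x y h0) (mul_nonneg (hπ x) (hQ x y hxy))

lemma dirichletForm_self_nonneg {Q : Matrix X X ℝ} {π : X → ℝ}
    (hQ : ∀ x y, x ≠ y → 0 ≤ Q x y) (hπ : ∀ x, 0 ≤ π x) (f : X → ℝ) :
    0 ≤ dirichletForm Q π f f := by
  have := dirichletForm_mono (f := 0) (g := 0) (f' := f) (g' := f) hQ hπ
    (fun x y _ => by simpa using mul_self_nonneg (f x - f y))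
  simpa [dirichletForm] using this

lemma dirichletForm_smul_left (Q : Matrix X X ℝ) (π : X → ℝ) (c : ℝ) (f g : X → ℝ) :
    dirichletForm Q π (fun x => c * f x) g = c * dirichletForm Q π f g := by
  simp only [dirichletForm, Finset.mul_sum]
  exact Finset.sum_congr rfl fun x _ => Finset.sum_congr rfl fun y _ => by ring

lemma dirichletForm_add_left (Q : Matrix X X ℝ) (π : X → ℝ) (f f' g : X → ℝ) :
    dirichletForm Q π (fun x => f x + f' x) g =
      dirichletForm Q π f g + dirichletForm Q π f' g := by
  simp only [dirichletForm, Finset.mul_sum, ← Finset.sum_add_distrib]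
  exact Finset.sum_congr rfl fun x _ => Finset.sum_congr rfl fun y _ => by ring

lemma dirichletForm_sub_left (Q : Matrix X X ℝ) (π : X → ℝ) (f f' g : X → ℝ) :
    dirichletForm Q π (fun x => f x - f' x) g =
      dirichletForm Q π f g - dirichletForm Q π f' g := by
  simp only [dirichletForm, Finset.mul_sum, ← Finset.sum_sub_distrib]
  exact Finset.sum_congr rfl fun x _ => Finset.sum_congr rfl fun y _ => by ring

namespace IsIrreducibleReversible

variable {Q : Matrix X X ℝ} {π : X → ℝ}

/-- The reversible law of an irreducible chain charges every state. -/
lemma prob_pos (H : IsIrreducibleReversible Q π) (x : X) : 0 < π x := by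
  obtain ⟨z, hz⟩ : ∃ z, 0 < π z := by
    by_contra! h
    have := Finset.sum_nonpos (s := Finset.univ) fun z _ => h z
    rw [H.prob_sum] at this
    linarith
  have key := H.irreducible z x
  induction key with
  | refl => exact hz
  | @tail b c _ hbc ih =>
    rcases eq_or_ne b c with rfl | hne
    · exact ih
    have h1 : 0 < π c * Q c b := by rw [← H.reversible b c]; positivity
    by_contra h0
    have : π c = 0 := le_antisymm (not_lt.1 h0) (H.prob_nonneg c)
    rw [this, zero_mul] at h1
    exact lt_irrefl _ h1

lemma dirichletForm_eq (H : IsIrreducibleReversible Q π) (f g : X → ℝ) :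
    dirichletForm Q π f g = -expect π (fun x => f x * ∑ y, Q x y * g y) :=
  MarkovChain.dirichletForm_eq H.row_sum H.reversible f g

lemma expect_gen (H : IsIrreducibleReversible Q π) (f : X → ℝ) :
    expect π (fun x => ∑ y, Q x y * f y) = 0 := by
  have h := H.dirichletForm_eq (fun _ => 1) f
  simp only [one_mul] at h
  have h2 : dirichletForm Q π (fun _ => 1) f = 0 := by simp [dirichletForm]
  linarith

/-- A function that does not change along jumps is constant. -/
lemma const_of_jumps (H : IsIrreducibleReversible Q π) {f : X → ℝ}
    (h : ∀ x y, 0 < Q x y → f x = f y) (x y : X) : f x = f y := by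
  have key := H.irreducible x y
  induction key with
  | refl => rfl
  | tail _ hbc ih => exact ih.trans (h _ _ hbc)

lemma jumps_of_dirichletForm_eq_zero (H : IsIrreducibleReversible Q π) {f : X → ℝ}
    (h : dirichletForm Q π f f = 0) (x y : X) (hxy : 0 < Q x y) : f x = f y := by
  have nn : ∀ x y, 0 ≤ π x * Q x y * (f x - f y) * (f x - f y) := by
    intro x y
    rcases eq_or_ne x y with rfl | hne
    · simp
    · rw [mul_assoc]
      exact mul_nonneg (mul_nonneg (H.prob_nonneg x) (H.rate_nonneg x y hne)) (mul_self_nonneg _)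
  have h0 : ∑ x, ∑ y, π x * Q x y * (f x - f y) * (f x - f y) = 0 := by
    simpa [dirichletForm] using h
  have h1 := (Finset.sum_eq_zero_iff_of_nonneg
    (fun x _ => Finset.sum_nonneg fun y _ => nn x y)).1 h0 x (Finset.mem_univ x)
  have h2 := (Finset.sum_eq_zero_iff_of_nonneg (fun y _ => nn x y)).1 h1 y (Finset.mem_univ y)
  have h3 : 0 < π x * Q x y := mul_pos (H.prob_pos x) hxy
  rw [mul_assoc] at h2
  have := mul_self_eq_zero.1 ((mul_eq_zero.1 h2).resolve_left h3.ne')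
  linarith

end IsIrreducibleReversible

end General

/-! ### The spectral gap -/

section Gap

variable {X : Type*} [Fintype X] {Q : Matrix X X ℝ} {π : X → ℝ}

lemma isEigen_rayleigh (H : IsIrreducibleReversible Q π) {l : ℝ} {f : X → ℝ}
    (hf : -(Q.mulVec f) = l • f) (g : X → ℝ) :
    dirichletForm Q π g f = l * expect π (fun x => g x * f x) := by
  rw [H.dirichletForm_eq, ← expect_smul]
  simp only [expect, ← Finset.sum_neg_distrib]
  refine Finset.sum_congr rfl fun x _ => ?_
  have := congrFun hf x
  simp only [Pi.neg_apply, Matrix.mulVec, dotProduct, Pi.smul_apply, smul_eq_mul] at this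
  linear_combination (π x * g x) * this

lemma spectralGap_bddBelow (H : IsIrreducibleReversible Q π) :
    BddBelow {l : ℝ | ∃ f : X → ℝ, f ≠ 0 ∧ expect π f = 0 ∧ -(Q.mulVec f) = l • f} := by
  refine ⟨0, ?_⟩
  rintro l ⟨f, hf0, -, hf⟩
  have h1 := isEigen_rayleigh H hf f
  have h2 := dirichletForm_self_nonneg H.rate_nonneg H.prob_nonneg f
  have h3 : 0 < expect π (fun x => f x * f x) := by
    refine lt_of_le_of_ne (expect_nonneg H.prob_nonneg fun x => mul_self_nonneg _) fun h => hf0 ?_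
    ext x
    simpa using eq_zero_of_expect_eq_zero H.prob_pos (fun x => mul_self_nonneg (f x)) h.symm x
  by_contra hl
  nlinarith

/-- The Rayleigh quotient attains its minimum over mean-zero functions; the minimiser is an
eigenfunction, and the minimum is positive by irreducibility. -/
lemma exists_rayleigh_min [Nontrivial X] (H : IsIrreducibleReversible Q π) :
    ∃ (l : ℝ) (φ : X → ℝ), 0 < l ∧ φ ≠ 0 ∧ expect π φ = 0 ∧ -(Q.mulVec φ) = l • φ ∧
      ∀ u : X → ℝ, expect π u = 0 → l * expect π (fun x => u x ^ 2) ≤ dirichletForm Q π u u := by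
  classical
  have cexp : ∀ F : X → (X → ℝ) → ℝ, (∀ x, Continuous (F x)) →
      Continuous fun f : X → ℝ => expect π (fun x => F x f) := by
    intro F hF
    unfold expect
    fun_prop
  have cn : Continuous fun f : X → ℝ => expect π (fun x => f x ^ 2) :=
    cexp (fun x f => f x ^ 2) fun x => by fun_prop
  have cm : Continuous fun f : X → ℝ => expect π f := cexp (fun x f => f x) fun x => by fun_prop
  have cE : Continuous fun f : X → ℝ => dirichletForm Q π f f := by
    unfold dirichletForm
    fun_prop
  let K : Set (X → ℝ) := {f | expect π f = 0 ∧ expect π (fun x => f x ^ 2) = 1}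
  have hKc : IsCompact K := by
    refine Metric.isCompact_of_isClosed_isBounded
      ((isClosed_eq cm continuous_const).inter (isClosed_eq cn continuous_const)) ?_
    obtain ⟨m, hm0, hm⟩ : ∃ m : ℝ, 0 < m ∧ ∀ x, m ≤ π x := by
      obtain ⟨x0, -, hx0⟩ := Finset.exists_min_image Finset.univ π Finset.univ_nonempty
      exact ⟨π x0, H.prob_pos x0, fun x => hx0 x (Finset.mem_univ x)⟩
    refine (Metric.isBounded_closedBall (x := (0 : X → ℝ)) (r := 1 / m + 1)).subset ?_
    rintro f ⟨-, hf⟩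
    rw [mem_closedBall_zero_iff, pi_norm_le_iff_of_nonneg (by positivity)]
    intro x
    have h1 : π x * f x ^ 2 ≤ 1 := by
      rw [← hf]
      exact Finset.single_le_sum (f := fun x => π x * f x ^ 2)
        (fun y _ => mul_nonneg (H.prob_nonneg y) (sq_nonneg _)) (Finset.mem_univ x)
    have h2 : f x ^ 2 ≤ 1 / m := by
      rw [le_div_iff₀ hm0]
      nlinarith [hm x, sq_nonneg (f x)]
    rw [Real.norm_eq_abs]
    have h3 : 0 < 1 / m := by positivity
    refine abs_le_of_sq_le_sq ?_ (by positivity)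
    nlinarith
  have normalise : ∀ u : X → ℝ, expect π u = 0 → u ≠ 0 → ∃ c : ℝ, 0 < c ∧
      c ^ 2 * expect π (fun x => u x ^ 2) = 1 ∧ (fun x => c * u x) ∈ K := by
    intro u hu hu0
    have hpos : 0 < expect π (fun x => u x ^ 2) := by
      refine lt_of_le_of_ne (expect_nonneg H.prob_nonneg fun x => sq_nonneg _) fun h => hu0 ?_
      ext x
      simpa using eq_zero_of_expect_eq_zero H.prob_pos (fun x => sq_nonneg (u x)) h.symm x
    have hc : (1 / √(expect π (fun x => u x ^ 2))) ^ 2 * expect π (fun x => u x ^ 2) = 1 := by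
      rw [div_pow, Real.sq_sqrt hpos.le]
      field_simp
    refine ⟨_, by positivity, hc, ?_, ?_⟩
    · rw [expect_smul, hu, mul_zero]
    · simp only [mul_pow]
      rw [expect_smul, hc]
  obtain ⟨a, b, hab⟩ := exists_pair_ne X
  have hKne : K.Nonempty := by
    obtain ⟨c, -, -, h⟩ := normalise (Pi.single a (1 / π a) - Pi.single b (1 / π b))
      (by
        have ha := (H.prob_pos a).ne'
        have hb := (H.prob_pos b).ne'
        simp [expect, mul_sub, Finset.sum_sub_distrib, Pi.single_apply, ha, hb])
      (fun h => by
        have := congrFun h a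
        simp [hab, (H.prob_pos a).ne'] at this)
    exact ⟨_, h⟩
  obtain ⟨φ, hφK, hφ⟩ := hKc.exists_isMinOn hKne cE.continuousOn
  set l := dirichletForm Q π φ φ with hl
  have hφ0 : φ ≠ 0 := by
    rintro rfl
    have := hφK.2
    simp [expect] at this
  have ray : ∀ u : X → ℝ, expect π u = 0 →
      l * expect π (fun x => u x ^ 2) ≤ dirichletForm Q π u u := by
    intro u hu
    by_cases hu0 : u = 0
    · simp [hu0, expect, dirichletForm]
    obtain ⟨c, hc, hc1, hcK⟩ := normalise u hu hu0
    have h1 : l ≤ dirichletForm Q π (fun x => c * u x) (fun x => c * u x) := hφ hcK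
    rw [dirichletForm_smul_left, dirichletForm_comm, dirichletForm_smul_left] at h1
    have : c ^ 2 * (l * expect π (fun x => u x ^ 2)) ≤ c ^ 2 * dirichletForm Q π u u := by
      rw [mul_left_comm, hc1]
      linarith
    exact le_of_mul_le_mul_left this (by positivity)
  have ortho : ∀ u : X → ℝ, expect π u = 0 →
      dirichletForm Q π u φ = l * expect π (fun x => u x * φ x) := by
    -- the quadratic `t ↦ ℰ(φ + t u) - l ‖φ + t u‖²` is nonnegative and vanishes at `0`
    intro u hu
    have hq : ∀ t : ℝ, 0 ≤ (dirichletForm Q π u u - l * expect π (fun x => u x ^ 2)) * (t * t)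
        + 2 * (dirichletForm Q π u φ - l * expect π (fun x => u x * φ x)) * t + 0 := by
      intro t
      have h := ray (fun x => φ x + t * u x) (by rw [expect_add, expect_smul, hu, hφK.1]; simp)
      have e1 : dirichletForm Q π (fun x => φ x + t * u x) (fun x => φ x + t * u x) =
          l + 2 * t * dirichletForm Q π u φ + t ^ 2 * dirichletForm Q π u u := by
        rw [dirichletForm_add_left, dirichletForm_smul_left,
          dirichletForm_comm Q π φ, dirichletForm_comm Q π u,
          dirichletForm_add_left, dirichletForm_add_left, dirichletForm_smul_left,
          dirichletForm_smul_left, dirichletForm_comm Q π φ u, ← hl]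
        ring
      have e2 : expect π (fun x => (φ x + t * u x) ^ 2) =
          1 + 2 * t * expect π (fun x => u x * φ x) + t ^ 2 * expect π (fun x => u x ^ 2) := by
        rw [← hφK.2, ← expect_smul, ← expect_smul, ← expect_add, ← expect_add]
        congr 1
        ext x
        ring
      rw [e1, e2] at h
      nlinarith
    have hd := discrim_le_zero hq
    rw [discrim] at hd
    have : (2 * (dirichletForm Q π u φ - l * expect π (fun x => u x * φ x))) ^ 2 = 0 :=
      le_antisymm (by linarith) (sq_nonneg _)
    have := pow_eq_zero_iff (two_ne_zero) |>.1 this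
    linarith
  have ortho' : ∀ u : X → ℝ, dirichletForm Q π u φ = l * expect π (fun x => u x * φ x) := by
    intro u
    have h := ortho (fun x => u x - expect π u)
      (by rw [expect_sub, expect_const H.prob_sum, sub_self])
    have e1 : dirichletForm Q π (fun x => u x - expect π u) φ = dirichletForm Q π u φ := by
      simp [dirichletForm]
    have e2 : expect π (fun x => (u x - expect π u) * φ x) = expect π (fun x => u x * φ x) := by
      simp only [sub_mul]
      rw [expect_sub, expect_smul, hφK.1, mul_zero, sub_zero]
    rwa [e1, e2] at h
  have hlpos : 0 < l := by
    refine lt_of_le_of_ne (dirichletForm_self_nonneg H.rate_nonneg H.prob_nonneg φ) fun h0 => ?_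
    have hc := H.const_of_jumps (H.jumps_of_dirichletForm_eq_zero (hl ▸ h0.symm))
    apply hφ0
    ext x
    have : expect π φ = φ x := by
      rw [← expect_const H.prob_sum (φ x)]
      congr 1
      ext y
      exact hc y x
    rw [← this, hφK.1]
    rfl
  refine ⟨l, φ, hlpos, hφ0, hφK.1, ?_, ray⟩
  ext x
  have h := ortho' (Pi.single x 1)
  rw [H.dirichletForm_eq] at h
  simp only [expect, Pi.single_apply, ite_mul, one_mul, zero_mul, mul_ite, mul_zero,
    Finset.sum_ite_eq', Finset.mem_univ, if_true] at h
  simp only [Pi.neg_apply, Matrix.mulVec, dotProduct, Pi.smul_apply, smul_eq_mul]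
  refine mul_left_cancel₀ (H.prob_pos x).ne' ?_
  linarith

/-- The spectral gap is attained by an eigenfunction, and the Poincaré inequality holds for
mean-zero functions. -/
lemma spectralGap_spec [Nontrivial X] (H : IsIrreducibleReversible Q π) :
    0 < spectralGap Q π ∧
    (∃ φ : X → ℝ, φ ≠ 0 ∧ expect π φ = 0 ∧ -(Q.mulVec φ) = spectralGap Q π • φ) ∧
    ∀ u : X → ℝ, expect π u = 0 →
      spectralGap Q π * expect π (fun x => u x ^ 2) ≤ dirichletForm Q π u u := by
  obtain ⟨l, φ, hl, hφ0, hφm, hφ, ray⟩ := exists_rayleigh_min H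
  have : spectralGap Q π = l := by
    refine le_antisymm (csInf_le (spectralGap_bddBelow H) ⟨φ, hφ0, hφm, hφ⟩)
      (le_csInf ⟨l, φ, hφ0, hφm, hφ⟩ ?_)
    rintro l' ⟨f, hf0, hfm, hf⟩
    have h1 := isEigen_rayleigh H hf f
    have h2 := ray f hfm
    have h3 : 0 < expect π (fun x => f x ^ 2) := by
      refine lt_of_le_of_ne (expect_nonneg H.prob_nonneg fun x => sq_nonneg _) fun h => hf0 ?_
      ext x
      simpa using eq_zero_of_expect_eq_zero H.prob_pos (fun x => sq_nonneg (f x)) h.symm x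
    simp only [← pow_two] at h1
    rw [h1] at h2
    exact le_of_mul_le_mul_right h2 h3
  rw [this]
  exact ⟨hl, ⟨φ, hφ0, hφm, hφ⟩, ray⟩

lemma poincare [Nontrivial X] (H : IsIrreducibleReversible Q π) (u : X → ℝ) :
    spectralGap Q π * expect π (fun x => (u x - expect π u) ^ 2) ≤ dirichletForm Q π u u := by
  have h := (spectralGap_spec H).2.2 (fun x => u x - expect π u)
    (by rw [expect_sub, expect_const H.prob_sum, sub_self])
  refine h.trans (le_of_eq ?_)
  simp [dirichletForm]

end Gap

end MarkovChain

namespace MarkovChain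

/-! ### Scalar inequalities and elementary entropy bounds -/

/-- Convexity of `(a, b) ↦ (√a - √b)²` at midpoints. -/
lemma sqrt_midpoint_sub_sq_le {a b c d : ℝ} (ha : 0 < a) (hb : 0 < b) (hc : 0 < c) (hd : 0 < d) :
    (√((a + b) / 2) - √((c + d) / 2)) ^ 2 ≤ ((√a - √c) ^ 2 + (√b - √d) ^ 2) / 2 := by
  have h1 : √a * √c + √b * √d ≤ 2 * (√((a + b) / 2) * √((c + d) / 2)) := by
    refine abs_le_of_sq_le_sq' ?_ (by positivity) |>.2
    have e1 := Real.sq_sqrt (show 0 ≤ (a + b) / 2 by positivity)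
    have e2 := Real.sq_sqrt (show 0 ≤ (c + d) / 2 by positivity)
    have e3 : (2 * (√((a + b) / 2) * √((c + d) / 2))) ^ 2 = (a + b) * (c + d) := by
      rw [mul_pow, mul_pow, e1, e2]; ring
    rw [e3]
    have a1 := Real.sq_sqrt ha.le
    have b1 := Real.sq_sqrt hb.le
    have c1 := Real.sq_sqrt hc.le
    have d1 := Real.sq_sqrt hd.le
    have : (a + b) * (c + d) = (√a ^ 2 + √b ^ 2) * (√c ^ 2 + √d ^ 2) := by
      rw [a1, b1, c1, d1]
    rw [this]
    nlinarith [sq_nonneg (√a * √d - √b * √c)]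
  nlinarith [Real.sq_sqrt (show 0 ≤ (a + b) / 2 by positivity),
    Real.sq_sqrt (show 0 ≤ (c + d) / 2 by positivity), Real.sq_sqrt ha.le, Real.sq_sqrt hb.le,
    Real.sq_sqrt hc.le, Real.sq_sqrt hd.le]

lemma mul_log_le {a m : ℝ} (ha : 0 < a) (hm : 0 < m) :
    a * Real.log a ≤ a * Real.log m + a * (a / m - 1) := by
  have h := Real.log_le_sub_one_of_pos (div_pos ha hm)
  rw [Real.log_div ha.ne' hm.ne'] at h
  nlinarith

/-- Logarithmic Sobolev inequality on the symmetric two-point space. -/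
lemma two_point_entropy_le {a b : ℝ} (ha : 0 < a) (hb : 0 < b) :
    (a * Real.log a + b * Real.log b) / 2 - (a + b) / 2 * Real.log ((a + b) / 2) ≤
      (√a - √b) ^ 2 := by
  have hm : 0 < (a + b) / 2 := by positivity
  have h1 := mul_log_le ha hm
  have h2 := mul_log_le hb hm
  have h3 : (a * (a / ((a + b) / 2) - 1) + b * (b / ((a + b) / 2) - 1)) / 2 ≤ (√a - √b) ^ 2 := by
    have e : (a * (a / ((a + b) / 2) - 1) + b * (b / ((a + b) / 2) - 1)) / 2 =
        (a - b) ^ 2 / (2 * (a + b)) := by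
      field_simp
      ring
    rw [e, div_le_iff₀ (by positivity)]
    have a1 := Real.sq_sqrt ha.le
    have b1 := Real.sq_sqrt hb.le
    have e2 : (a - b) ^ 2 = (√a - √b) ^ 2 * (√a + √b) ^ 2 := by
      rw [← mul_pow, ← a1, ← b1]
      simp only [Real.sqrt_sq (Real.sqrt_nonneg _)]
      ring
    rw [e2]
    refine mul_le_mul_of_nonneg_left ?_ (sq_nonneg _)
    nlinarith [sq_nonneg (√a - √b)]
  linarith

/-- `(a - b)(log a - log b)` dominates `2 (√a - √b)²`. -/
lemma two_mul_sqrt_sub_sq_le {a b : ℝ} (ha : 0 < a) (hb : 0 < b) :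
    2 * ((√a - √b) * (√a - √b)) ≤ (a - b) * (Real.log a - Real.log b) := by
  wlog hab : b ≤ a generalizing a b
  · have := this hb ha (le_of_not_ge hab)
    nlinarith
  have hx : 0 < √a := Real.sqrt_pos.2 ha
  have hy : 0 < √b := Real.sqrt_pos.2 hb
  have hxy : √b ≤ √a := Real.sqrt_le_sqrt hab
  have a1 := Real.sq_sqrt ha.le
  have b1 := Real.sq_sqrt hb.le
  generalize √a = x at *
  generalize √b = y at *
  subst a1 b1
  rw [Real.log_pow, Real.log_pow]
  have h := Real.one_sub_inv_le_log_of_pos (div_pos hx hy)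
  rw [Real.log_div hx.ne' hy.ne', inv_div] at h
  have h2 : (x ^ 2 - y ^ 2) * (1 - y / x) = (x - y) * (x - y) * (1 + y / x) := by
    field_simp
    ring
  have h3 : 0 ≤ y / x := by positivity
  have h4 : 0 ≤ x ^ 2 - y ^ 2 := by nlinarith
  push_cast
  nlinarith [mul_le_mul_of_nonneg_left h h4, mul_nonneg (mul_self_nonneg (x - y)) h3]

/-- Converse of `two_mul_sqrt_sub_sq_le` when `a` and `b` are comparable. -/
lemma sub_mul_log_sub_le {a b B : ℝ} (ha : 0 < a) (hb : 0 < b) (hB : 1 ≤ B) (hab : a ≤ B * b)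
    (hba : b ≤ B * a) :
    (a - b) * (Real.log a - Real.log b) ≤ 4 * B * ((√a - √b) * (√a - √b)) := by
  wlog hle : b ≤ a generalizing a b
  · have := this hb ha hba hab (le_of_not_ge hle)
    nlinarith
  have hx : 0 < √a := Real.sqrt_pos.2 ha
  have hy : 0 < √b := Real.sqrt_pos.2 hb
  have hxy : √b ≤ √a := Real.sqrt_le_sqrt hle
  have a1 := Real.sq_sqrt ha.le
  have b1 := Real.sq_sqrt hb.le
  generalize √a = x at *
  generalize √b = y at *
  subst a1 b1
  rw [Real.log_pow, Real.log_pow]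
  have h := Real.log_le_sub_one_of_pos (div_pos hx hy)
  rw [Real.log_div hx.ne' hy.ne'] at h
  have h4 : 0 ≤ x ^ 2 - y ^ 2 := by nlinarith
  have hxB : x ≤ B * y := by
    refine abs_le_of_sq_le_sq' ?_ (by positivity) |>.2
    nlinarith [mul_nonneg (sub_nonneg.2 hB) (by positivity : 0 ≤ B * y ^ 2)]
  have h2 : (x ^ 2 - y ^ 2) * (x / y - 1) = (x - y) * (x - y) * (x / y + 1) := by
    field_simp
    ring
  have h3 : x / y ≤ B := by rwa [div_le_iff₀ hy]
  push_cast
  nlinarith [mul_le_mul_of_nonneg_left h h4,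
    mul_le_mul_of_nonneg_left (add_le_add_left h3 1) (mul_self_nonneg (x - y)),
    mul_nonneg (mul_self_nonneg (x - y)) (sub_nonneg.2 hB)]

section

variable {X : Type*} [Fintype X]

/-- A crude logarithmic Sobolev inequality: entropy of a square is controlled by the variance, with
a constant inversely proportional to the smallest atom. -/
lemma ent_sq_le {π : X → ℝ} {m : ℝ} (hm : 0 < m) (hπm : ∀ x, m ≤ π x) (h1 : ∑ x, π x = 1)
    {g : X → ℝ} (hg : ∀ x, 0 < g x) :
    ent π (fun x => g x ^ 2) ≤ 4 / m * expect π (fun x => (g x - expect π g) ^ 2) := by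
  have hπ : ∀ x, 0 ≤ π x := fun x => hm.le.trans (hπm x)
  have hne : Nonempty X := by
    by_contra h
    rw [not_nonempty_iff] at h
    simp at h1
  have hle : ∀ (u : X → ℝ), (∀ x, 0 ≤ u x) → ∀ x, π x * u x ≤ expect π u := fun u hu x =>
    Finset.single_le_sum (f := fun x => π x * u x) (fun y _ => mul_nonneg (hπ y) (hu y))
      (Finset.mem_univ x)
  have hm1 : m ≤ 1 := by
    have := hle (fun _ => 1) (fun _ => zero_le_one) hne.some
    rw [expect_const h1] at this
    linarith [hπm hne.some]
  set M := expect π (fun x => g x ^ 2) with hM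
  set a := expect π g with ha
  have hM0 : 0 < M := by
    obtain ⟨x⟩ := hne
    have := hle (fun x => g x ^ 2) (fun x => sq_nonneg _) x
    have : 0 < π x * g x ^ 2 := mul_pos (hm.trans_le (hπm x)) (pow_pos (hg x) 2)
    linarith
  have haM : a ^ 2 ≤ M := sq_expect_le hπ h1 g
  have e1 : ent π (fun x => g x ^ 2) ≤ (expect π (fun x => (g x ^ 2) ^ 2) - M ^ 2) / M := by
    have h2 : expect π (fun x => g x ^ 2 * Real.log (g x ^ 2)) ≤
        expect π (fun x => Real.log M * g x ^ 2 + (1 / M * (g x ^ 2) ^ 2 - g x ^ 2)) := by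
      refine expect_mono hπ fun x => ?_
      have := mul_log_le (pow_pos (hg x) 2) hM0
      refine this.trans (le_of_eq ?_)
      field_simp
    rw [expect_add, expect_sub, expect_smul, expect_smul, ← hM] at h2
    rw [ent, ← hM]
    have : (expect π (fun x => (g x ^ 2) ^ 2) - M ^ 2) / M =
        1 / M * expect π (fun x => (g x ^ 2) ^ 2) - M := by
      field_simp
    rw [this]
    linarith
  have e2 : expect π (fun x => (g x ^ 2) ^ 2) - M ^ 2 ≤
      expect π (fun x => (g x ^ 2 - a ^ 2) ^ 2) := by
    rw [expect_sub_sq h1, ← hM]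
    nlinarith [sq_nonneg (M - a ^ 2)]
  have e3 : expect π (fun x => (g x ^ 2 - a ^ 2) ^ 2) ≤
      4 * M / m * expect π (fun x => (g x - a) ^ 2) := by
    rw [← expect_smul]
    refine expect_mono hπ fun x => ?_
    have h3 : g x ^ 2 ≤ M / m := by
      rw [le_div_iff₀ hm]
      have := hle (fun x => g x ^ 2) (fun x => sq_nonneg _) x
      nlinarith [hπm x, sq_nonneg (g x)]
    have h4 : a ^ 2 ≤ M / m := by
      refine haM.trans ?_
      rw [le_div_iff₀ hm]
      nlinarith
    have h5 : (g x + a) ^ 2 ≤ 4 * M / m := by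
      have : 4 * M / m = 4 * (M / m) := by ring
      nlinarith [sq_nonneg (g x - a)]
    have : (g x ^ 2 - a ^ 2) ^ 2 = (g x + a) ^ 2 * (g x - a) ^ 2 := by ring
    rw [this]
    exact mul_le_mul_of_nonneg_right h5 (sq_nonneg _)
  calc _ ≤ _ := e1
    _ ≤ 4 * M / m * expect π (fun x => (g x - a) ^ 2) / M :=
        div_le_div_of_nonneg_right (e2.trans e3) hM0.le
    _ = _ := by field_simp

/-- The root mean square is no worse a centre than the mean, up to a factor `2`. -/
lemma expect_sub_sqrt_sq_le {π : X → ℝ} (hπ : ∀ x, 0 ≤ π x) (h1 : ∑ x, π x = 1)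
    {g : X → ℝ} (hg : ∀ x, 0 ≤ g x) :
    expect π (fun x => (g x - √(expect π fun x => g x ^ 2)) ^ 2) ≤
      2 * expect π (fun x => (g x - expect π g) ^ 2) := by
  have hM : 0 ≤ expect π (fun x => g x ^ 2) := expect_nonneg hπ fun x => sq_nonneg _
  have ha : 0 ≤ expect π g := expect_nonneg hπ hg
  have haM := sq_expect_le hπ h1 g
  rw [expect_sub_sq h1, expect_sub_sq h1]
  have hr := Real.sqrt_nonneg (expect π fun x => g x ^ 2)
  have hs := Real.sq_sqrt hM
  rw [← hs] at haM ⊢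
  simp only [Real.sqrt_sq hr]
  have har := abs_le_of_sq_le_sq' haM hr |>.2
  generalize √(expect π fun x => g x ^ 2) = r at *
  nlinarith [mul_nonneg ha (sub_nonneg.2 har)]

lemma expect_comm {Y : Type*} [Fintype Y] (π : X → ℝ) (ρ : Y → ℝ) (F : X → Y → ℝ) :
    expect π (fun x => expect ρ (fun y => F x y)) =
      expect ρ (fun y => expect π (fun x => F x y)) := by
  simp only [expect, Finset.mul_sum]
  rw [Finset.sum_comm]
  exact Finset.sum_congr rfl fun y _ => Finset.sum_congr rfl fun x _ => by ring

lemma dirichletForm_self (Q : Matrix X X ℝ) (π : X → ℝ) (g : X → ℝ) :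
    dirichletForm Q π g g = 1 / 2 * expect π (fun x => ∑ y, Q x y * (g y - g x) ^ 2) := by
  simp only [dirichletForm, expect, Finset.mul_sum]
  exact Finset.sum_congr rfl fun x _ => Finset.sum_congr rfl fun y _ => by ring

end

end MarkovChain

namespace Lamplighter

open MarkovChain

/-! ### The walk and the lamplighter as reversible chains -/

variable {V : Type*} [Fintype V] [DecidableEq V]

@[simp] lemma flip_self (σ : V → Bool) (i : V) : flip σ i i = !σ i := by simp [flip]

lemma flip_of_ne (σ : V → Bool) {i j : V} (h : j ≠ i) : flip σ i j = σ j := by simp [flip, h]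

@[simp] lemma flip_flip (σ : V → Bool) (i : V) : flip (flip σ i) i = σ := by
  ext j
  by_cases h : j = i <;> simp [flip, h]

lemma flip_comm (σ : V → Bool) (i j : V) : flip (flip σ i) j = flip (flip σ j) i := by
  ext l
  rcases eq_or_ne i j with rfl | h
  · rfl
  by_cases h1 : l = i
  · subst h1; simp [flip, h]
  · by_cases h2 : l = j
    · subst h2; simp [flip, h1]
    · simp [flip, h1, h2]

lemma flip_ne (σ : V → Bool) (i : V) : flip σ i ≠ σ := fun h => by
  have := congrFun h i
  simp at this

lemma eq_flip_comm {σ τ : V → Bool} {i : V} : τ = flip σ i ↔ σ = flip τ i := by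
  constructor <;> rintro rfl <;> simp

/-- Every configuration is reached from any other by successive flips. -/
lemma flip_induction {p : (V → Bool) → Prop} (σ : V → Bool) (h0 : p σ)
    (hs : ∀ τ x, p τ → p (flip τ x)) (τ : V → Bool) : p τ := by
  have key : ∀ (T : Finset V) (ρ : V → Bool), (∀ x, x ∉ T → ρ x = σ x) → p ρ := by
    intro T
    induction T using Finset.induction_on with
    | empty =>
      intro ρ h
      rwa [show ρ = σ from funext fun x => h x (by simp)]
    | insert a T ha ih =>
      intro ρ h
      by_cases e : ρ a = σ a
      · refine ih ρ fun x hx => ?_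
        by_cases hxa : x = a
        · rw [hxa, e]
        · exact h x (by simp [hxa, hx])
      · rw [← flip_flip ρ a]
        refine hs _ _ (ih _ fun x hx => ?_)
        by_cases hxa : x = a
        · subst hxa
          rw [flip_self]
          revert e
          cases ρ x <;> cases σ x <;> simp
        · rw [flip_of_ne _ hxa]
          exact h x (by simp [hxa, hx])
  exact key Finset.univ τ fun x hx => absurd (Finset.mem_univ x) hx

/-- The law of independent fair lamps. -/
noncomputable def coin (V : Type*) [Fintype V] : (V → Bool) → ℝ := fun _ => (1 / 2) ^ Fintype.card V

lemma coin_pos (σ : V → Bool) : 0 < coin V σ := by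
  unfold coin
  positivity

lemma coin_sum : ∑ σ, coin V σ = 1 := by
  simp [coin, Finset.sum_const, Finset.card_univ]

/-- Flipping a lamp preserves the law of fair lamps. -/
lemma expect_coin_flip (F : (V → Bool) → ℝ) (x : V) :
    expect (coin V) (fun σ => F (flip σ x)) = expect (coin V) F := by
  let e : (V → Bool) ≃ (V → Bool) := Function.Involutive.toPerm (fun σ => flip σ x)
    (fun σ => flip_flip σ x)
  exact Equiv.sum_comp e (fun σ => coin V σ * F σ)

variable (G : SimpleGraph V) [DecidableRel G.Adj]

lemma walkGen_sum (f : V → ℝ) (i : V) : ∑ j, walkGen G i j * f j =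
    (1 / (G.degree i : ℝ)) * ∑ j ∈ G.neighborFinset i, (f j - f i) := by
  unfold walkGen
  rw [sum_toMatrix_mul]
  constructor
  · intro f g
    ext i
    simp only [Pi.add_apply, ← mul_add, ← Finset.sum_add_distrib]
    congr 1
    exact Finset.sum_congr rfl fun _ _ => by ring
  · intro c f
    ext i
    simp only [Pi.smul_apply, smul_eq_mul, Finset.mul_sum]
    exact Finset.sum_congr rfl fun _ _ => by ring

lemma lampGen_sum (f : V × (V → Bool) → ℝ) (x : V × (V → Bool)) : ∑ y, lampGen G x y * f y =
    (1 / 2) * (f (x.1, flip x.2 x.1) - f (x.1, x.2)) +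
      (1 / (2 * (G.degree x.1 : ℝ))) *
        ∑ j ∈ G.neighborFinset x.1, (f (j, x.2) - f (x.1, x.2)) := by
  unfold lampGen
  rw [sum_toMatrix_mul]
  constructor
  · intro f g
    ext x
    have : ∑ j ∈ G.neighborFinset x.1, ((f + g) (j, x.2) - (f + g) (x.1, x.2)) =
        ∑ j ∈ G.neighborFinset x.1, (f (j, x.2) - f (x.1, x.2)) +
        ∑ j ∈ G.neighborFinset x.1, (g (j, x.2) - g (x.1, x.2)) := by
      rw [← Finset.sum_add_distrib]
      exact Finset.sum_congr rfl fun _ _ => by simp only [Pi.add_apply]; ring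
    rw [this]
    simp only [Pi.add_apply]
    ring
  · intro c f
    ext x
    have : ∑ j ∈ G.neighborFinset x.1, ((c • f) (j, x.2) - (c • f) (x.1, x.2)) =
        c * ∑ j ∈ G.neighborFinset x.1, (f (j, x.2) - f (x.1, x.2)) := by
      rw [Finset.mul_sum]
      exact Finset.sum_congr rfl fun _ _ => by simp only [Pi.smul_apply, smul_eq_mul]; ring
    rw [this]
    simp only [Pi.smul_apply, smul_eq_mul]
    ring

lemma walkGen_apply {i j : V} (h : i ≠ j) :
    walkGen G i j = if G.Adj i j then 1 / (G.degree i : ℝ) else 0 := by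
  have := walkGen_sum G (Pi.single j 1) i
  simp only [Pi.single_apply, mul_ite, mul_one, mul_zero, Finset.sum_ite_eq', Finset.mem_univ,
    if_true, if_neg h, sub_zero, SimpleGraph.mem_neighborFinset] at this
  rw [this]

lemma lampGen_apply {x y : V × (V → Bool)} (h : x ≠ y) :
    lampGen G x y = (1 / 2) * (if y = (x.1, flip x.2 x.1) then 1 else 0) +
      (1 / (2 * (G.degree x.1 : ℝ))) * (if G.Adj x.1 y.1 ∧ y.2 = x.2 then 1 else 0) := by
  have := lampGen_sum G (Pi.single y 1) x
  simp only [Pi.single_apply, mul_ite, mul_one, mul_zero, Finset.sum_ite_eq', Finset.mem_univ,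
    if_true, Prod.mk.eta, if_neg h, sub_zero] at this
  rw [this]
  have e : ∑ j ∈ G.neighborFinset x.1, (if (j, x.2) = y then (1 : ℝ) else 0) =
      if G.Adj x.1 y.1 ∧ y.2 = x.2 then 1 else 0 := by
    obtain ⟨y1, y2⟩ := y
    by_cases h2 : y2 = x.2
    · simp [h2, Prod.ext_iff]
    · simp [h2, Prod.ext_iff, Ne.symm h2]
  rw [e]
  simp only [mul_ite, mul_one, mul_zero, eq_comm]

variable {G}

section Connected

variable [Nontrivial V]

lemma degree_pos (hG : G.Connected) (i : V) : (0 : ℝ) < G.degree i := by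
  exact_mod_cast hG.preconnected.degree_pos_of_nontrivial i

lemma sum_degree_pos (hG : G.Connected) : (0 : ℝ) < ∑ j, (G.degree j : ℝ) :=
  Finset.sum_pos (fun i _ => degree_pos hG i) Finset.univ_nonempty

lemma one_div_sum_degree_le_walkLaw (hG : G.Connected) (i : V) : 1 / ∑ j, (G.degree j : ℝ) ≤ walkLaw G i := by
  unfold walkLaw
  refine div_le_div_of_nonneg_right ?_ (sum_degree_pos hG).le
  have := hG.preconnected.degree_pos_of_nontrivial i
  exact_mod_cast this

lemma walk_isIrreducibleReversible (hG : G.Connected) : IsIrreducibleReversible (walkGen G) (walkLaw G) where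
  rate_nonneg i j h := by
    rw [walkGen_apply G h]
    split_ifs <;> positivity
  row_sum i := by simpa using walkGen_sum G (fun _ => 1) i
  irreducible i j := by
    obtain ⟨p⟩ := hG.preconnected i j
    induction p with
    | nil => exact .refl
    | @cons u v w h p ih =>
      refine .head ?_ ih
      rw [walkGen_apply G h.ne, if_pos h]
      have := degree_pos hG u
      positivity
  prob_nonneg i := (by unfold walkLaw; positivity)
  prob_sum := by
    unfold walkLaw
    rw [← Finset.sum_div, div_self (sum_degree_pos hG).ne']
  reversible i j := by
    rcases eq_or_ne i j with rfl | h
    · rfl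
    rw [walkGen_apply G h, walkGen_apply G h.symm]
    by_cases ha : G.Adj i j
    · rw [if_pos ha, if_pos ha.symm]
      have := (degree_pos hG i).ne'
      have := (degree_pos hG j).ne'
      unfold walkLaw
      field_simp
    · rw [if_neg ha, if_neg (fun h => ha h.symm)]
      simp

lemma walkLaw_pos (hG : G.Connected) (i : V) : 0 < walkLaw G i := (walk_isIrreducibleReversible hG).prob_pos i

lemma walkLaw_sum (hG : G.Connected) : ∑ i, walkLaw G i = 1 := (walk_isIrreducibleReversible hG).prob_sum

end Connected

variable (G) in
lemma expect_lampLaw (f : V × (V → Bool) → ℝ) : expect (lampLaw G) f =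
    expect (walkLaw G) (fun i => expect (coin V) (fun σ => f (i, σ))) := by
  simp only [expect, Fintype.sum_prod_type, Finset.mul_sum]
  exact Finset.sum_congr rfl fun i _ => Finset.sum_congr rfl fun σ _ => by
    simp only [lampLaw, coin]; ring

lemma lamp_isIrreducibleReversible [Nontrivial V] (hG : G.Connected) :
    IsIrreducibleReversible (lampGen G) (lampLaw G) where
  rate_nonneg x y h := by
    rw [lampGen_apply G h]
    split_ifs <;> positivity
  row_sum x := by simpa using lampGen_sum G (fun _ => 1) x
  irreducible := by
    have flips : ∀ (i : V) σ, 0 < lampGen G (i, σ) (i, flip σ i) := by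
      intro i σ
      rw [lampGen_apply G (by simp [Prod.ext_iff, (flip_ne σ i).symm])]
      simp
    have moves : ∀ (i j : V) σ,
        Relation.ReflTransGen (fun a b => 0 < lampGen G a b) (i, σ) (j, σ) := by
      intro i j σ
      obtain ⟨p⟩ := hG.preconnected i j
      induction p with
      | nil => exact .refl
      | @cons u v w h p ih =>
        refine .head ?_ ih
        rw [lampGen_apply G (by simp [h.ne])]
        have := degree_pos hG u
        have h2 : (v, σ) ≠ (u, flip σ u) := by simp [h.ne']
        simp [h, h2, this]
    rintro ⟨i, σ⟩ ⟨j, τ⟩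
    refine flip_induction (p := fun τ => Relation.ReflTransGen (fun a b => 0 < lampGen G a b)
      (i, σ) (j, τ)) σ (moves i j σ) (fun τ x h => ?_) τ
    exact ((h.trans (moves j x τ)).tail (flips x τ)).trans (moves x j _)
  prob_nonneg x := (by unfold lampLaw walkLaw; positivity)
  prob_sum := by
    have h := expect_lampLaw G (fun _ => 1)
    simp only [expect_const coin_sum, expect_const (walkLaw_sum hG)] at h
    simpa [expect] using h
  reversible x y := by
    rcases eq_or_ne x y with rfl | h
    · rfl
    obtain ⟨i, σ⟩ := x
    obtain ⟨j, τ⟩ := y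
    rw [lampGen_apply G h, lampGen_apply G h.symm]
    have h1 : ((j, τ) = (i, flip σ i)) ↔ ((i, σ) = (j, flip τ j)) := by
      simp only [Prod.ext_iff]
      constructor <;> rintro ⟨rfl, h⟩ <;> exact ⟨rfl, eq_flip_comm.1 h⟩
    have h2 : (G.Adj i j ∧ τ = σ) ↔ (G.Adj j i ∧ σ = τ) := by
      rw [G.adj_comm, eq_comm (a := τ)]
    have d1 := (degree_pos hG i).ne'
    have d2 := (degree_pos hG j).ne'
    simp only [h2, lampLaw, walkLaw]
    by_cases c1 : (j, τ) = (i, flip σ i)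
    · have c3 : j = i := congrArg Prod.fst c1
      have c1' := h1.1 c1
      subst c3
      rw [if_pos c1, if_pos c1']
    · rw [if_neg c1, if_neg (fun h => c1 (h1.2 h))]
      field_simp
      simp

/-- The Dirichlet form of the lamplighter splits into a flip part and a walk part. -/
lemma lamp_dirichletForm_self (g : V × (V → Bool) → ℝ) :
    dirichletForm (lampGen G) (lampLaw G) g g =
      1 / 4 * expect (coin V) (fun σ => expect (walkLaw G)
        (fun i => (g (i, flip σ i) - g (i, σ)) ^ 2)) +
      1 / 2 * expect (coin V) (fun σ => dirichletForm (walkGen G) (walkLaw G)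
        (fun i => g (i, σ)) (fun i => g (i, σ))) := by
  simp only [dirichletForm_self, lampGen_sum, walkGen_sum]
  rw [expect_lampLaw, expect_comm, ← expect_smul, ← expect_smul, ← expect_smul, ← expect_add]
  congr 1
  ext σ
  rw [← expect_smul, ← expect_smul, ← expect_smul, ← expect_smul, ← expect_add]
  congr 1
  ext i
  simp only [sub_self, ne_eq, OfNat.ofNat_ne_zero, not_false_eq_true, zero_pow, sub_zero,
    one_div, mul_inv]
  ring

end Lamplighter

namespace MarkovChain

/-- A chain with holding rates at most `1` satisfies `ℰ(f, f) ≤ 2 ‖f‖²`. -/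
lemma dirichletForm_self_le {X : Type*} [Fintype X] {Q : Matrix X X ℝ} {π : X → ℝ}
    (H : IsIrreducibleReversible Q π) (hd : ∀ x, -1 ≤ Q x x) (f : X → ℝ) :
    dirichletForm Q π f f ≤ 2 * expect π (fun x => f x ^ 2) := by
  classical
  have s1 : ∑ x, ∑ y, π x * Q x y * (2 * f x ^ 2) = 0 := by
    simp [← Finset.sum_mul, ← Finset.mul_sum, H.row_sum]
  have s2 : ∑ x, ∑ y, π x * Q x y * (2 * f y ^ 2) = 0 := by
    have := H.expect_gen (fun y => 2 * f y ^ 2)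
    simpa only [expect, Finset.mul_sum, ← mul_assoc] using this
  have s3 : ∑ x, ∑ y, (if y = x then π x * (4 * f x ^ 2) else 0) =
      4 * expect π (fun x => f x ^ 2) := by
    simp only [Finset.sum_ite_eq', Finset.mem_univ, if_true, expect,
      Finset.mul_sum]
    exact Finset.sum_congr rfl fun x _ => by ring
  have key : ∑ x, ∑ y, π x * Q x y * (f x - f y) * (f x - f y) ≤
      ∑ x, ∑ y, (π x * Q x y * (2 * f x ^ 2) + π x * Q x y * (2 * f y ^ 2) +
        (if y = x then π x * (4 * f x ^ 2) else 0)) := by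
    refine Finset.sum_le_sum fun x _ => Finset.sum_le_sum fun y _ => ?_
    rcases eq_or_ne y x with rfl | h
    · rw [if_pos rfl]
      nlinarith [mul_nonneg (mul_nonneg (H.prob_nonneg y) (sq_nonneg (f y)))
        (by linarith [hd y] : 0 ≤ Q y y + 1)]
    · rw [if_neg h]
      nlinarith [mul_nonneg (mul_nonneg (H.prob_nonneg x) (H.rate_nonneg x y h.symm))
        (sq_nonneg (f x + f y))]
  simp only [Finset.sum_add_distrib, s1, s2, s3] at key
  rw [dirichletForm]
  linarith

end MarkovChain

namespace Lamplighter

open MarkovChain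

variable {V : Type*} [Fintype V] [DecidableEq V]

/-! ### Upper bound for the modified log-Sobolev constant -/

/-- Logarithmic Sobolev inequality for independent fair lamps, for functions of the lamps in `T`.
Lamps are averaged out one at a time: each step costs a two-point entropy, and averaging does not
increase the remaining terms, by convexity of `(a, b) ↦ (√a - √b)²`. -/
lemma ent_coin_le_of_invariant (T : Finset V) (F : (V → Bool) → ℝ) (hF : ∀ σ, 0 < F σ)
    (hT : ∀ x, x ∉ T → ∀ σ, F (flip σ x) = F σ) :
    ent (coin V) F ≤ ∑ x ∈ T, expect (coin V) (fun σ => (√(F σ) - √(F (flip σ x))) ^ 2) := by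
  induction T using Finset.induction_on generalizing F with
  | empty =>
    let σ₀ : V → Bool := fun _ => false
    have hc : F = fun _ => F σ₀ := by
      ext τ
      refine flip_induction (p := fun τ => F τ = F σ₀) σ₀ rfl (fun τ x h => ?_) τ
      rw [hT x (by simp), h]
    rw [hc]
    simp [ent, expect_const coin_sum]
  | insert a T ha ih =>
    set H : (V → Bool) → ℝ := fun σ => (F σ + F (flip σ a)) / 2 with hH
    have hHpos : ∀ σ, 0 < H σ := fun σ => by
      have := hF σ
      have := hF (flip σ a)
      simp only [hH]
      positivity
    have hHinv : ∀ x, x ∉ T → ∀ σ, H (flip σ x) = H σ := by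
      intro x hx σ
      by_cases hxa : x = a
      · subst hxa
        simp only [hH, flip_flip]
        ring
      · simp only [hH]
        rw [flip_comm, hT x (by simp [hxa, hx]), hT x (by simp [hxa, hx])]
    have hmean : expect (coin V) H = expect (coin V) F := by
      have : H = fun σ => 1 / 2 * F σ + 1 / 2 * F (flip σ a) := by
        ext σ
        simp only [hH]
        ring
      rw [this, expect_add, expect_smul, expect_smul, expect_coin_flip F a]
      ring
    have step : expect (coin V) (fun σ => F σ * Real.log (F σ)) -
        expect (coin V) (fun σ => H σ * Real.log (H σ)) ≤
        expect (coin V) (fun σ => (√(F σ) - √(F (flip σ a))) ^ 2) := by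
      have e : expect (coin V) (fun σ => F σ * Real.log (F σ)) = expect (coin V) (fun σ =>
          1 / 2 * (F σ * Real.log (F σ)) + 1 / 2 *
            (F (flip σ a) * Real.log (F (flip σ a)))) := by
        rw [expect_add, expect_smul, expect_smul,
          expect_coin_flip (fun σ => F σ * Real.log (F σ)) a]
        ring
      rw [e, ← expect_sub]
      refine expect_mono (fun σ => (coin_pos σ).le) fun σ => ?_
      have := two_point_entropy_le (hF σ) (hF (flip σ a))
      simp only [hH]
      linarith
    have conv : ∀ x, expect (coin V) (fun σ => (√(H σ) - √(H (flip σ x))) ^ 2) ≤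
        expect (coin V) (fun σ => (√(F σ) - √(F (flip σ x))) ^ 2) := by
      intro x
      have e : expect (coin V) (fun σ => (√(F σ) - √(F (flip σ x))) ^ 2) =
          expect (coin V) (fun σ => 1 / 2 * (√(F σ) - √(F (flip σ x))) ^ 2 +
            1 / 2 * (√(F (flip σ a)) - √(F (flip (flip σ a) x))) ^ 2) := by
        rw [expect_add, expect_smul, expect_smul,
          expect_coin_flip (fun σ => (√(F σ) - √(F (flip σ x))) ^ 2) a]
        ring
      rw [e]
      refine expect_mono (fun σ => (coin_pos σ).le) fun σ => ?_
      have := sqrt_midpoint_sub_sq_le (hF σ) (hF (flip σ a)) (hF (flip σ x))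
        (hF (flip (flip σ x) a))
      rw [flip_comm σ x a] at this
      simp only [hH]
      rw [flip_comm σ x a]
      linarith
    rw [Finset.sum_insert ha]
    have h2 := (ih H hHpos hHinv).trans (Finset.sum_le_sum fun x _ => conv x)
    rw [ent, hmean] at h2
    rw [ent]
    linarith

variable {G : SimpleGraph V} [DecidableRel G.Adj] [Nontrivial V]

lemma walkGen_diag (hG : G.Connected) (i : V) : walkGen G i i = -1 := by
  have := walkGen_sum G (Pi.single i 1) i
  simp only [Pi.single_apply, mul_ite, mul_one, mul_zero, Finset.sum_ite_eq', Finset.mem_univ,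
    if_true] at this
  rw [this]
  have h : ∀ j ∈ G.neighborFinset i, (if j = i then (1 : ℝ) else 0) - 1 = -1 := by
    intro j hj
    rw [if_neg]
    · simp
    · rintro rfl
      simp at hj
  rw [Finset.sum_congr rfl h, Finset.sum_const, SimpleGraph.card_neighborFinset_eq_degree]
  have := (degree_pos hG i).ne'
  field_simp
  simp

lemma lampGen_diag (hG : G.Connected) (x : V × (V → Bool)) : lampGen G x x = -1 := by
  have := lampGen_sum G (Pi.single x 1) x
  simp only [Pi.single_apply, mul_ite, mul_one, mul_zero, Finset.sum_ite_eq', Finset.mem_univ,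
    if_true, Prod.mk.eta] at this
  rw [this]
  have h : ∀ j ∈ G.neighborFinset x.1, (if (j, x.2) = x then (1 : ℝ) else 0) - 1 = -1 := by
    intro j hj
    rw [if_neg]
    · simp
    · intro h
      have : j = x.1 := congrArg Prod.fst h
      simp [this] at hj
  rw [Finset.sum_congr rfl h, Finset.sum_const, SimpleGraph.card_neighborFinset_eq_degree,
    if_neg (fun h => flip_ne x.2 x.1 (congrArg Prod.snd h))]
  have := (degree_pos hG x.1).ne'
  field_simp
  simp only [smul_neg, nsmul_eq_mul, mul_one, zero_sub]
  ring

lemma gap_pos (hG : G.Connected) : 0 < gap G :=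
  (spectralGap_spec (walk_isIrreducibleReversible hG)).1

lemma gap_le_two (hG : G.Connected) : gap G ≤ 2 := by
  have H := walk_isIrreducibleReversible hG
  obtain ⟨φ, h0, -, h⟩ := (spectralGap_spec H).2.1
  have h1 := isEigen_rayleigh H h φ
  have h2 := dirichletForm_self_le H (fun i => (walkGen_diag hG i).ge) φ
  simp only [← pow_two] at h1
  rw [h1] at h2
  refine le_of_mul_le_mul_right h2 ?_
  refine lt_of_le_of_ne (expect_nonneg H.prob_nonneg fun x => sq_nonneg _) fun h => h0 ?_
  ext x
  simpa using eq_zero_of_expect_eq_zero H.prob_pos (fun x => sq_nonneg (φ x)) h.symm x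

/-- The entropy inequality behind the upper bound. The entropy is split into that of the position
given the lamps and that of the lamps' marginal `F`. The discrepancy `√F(σ) - √F(σˣ)` is compared
with the flip at `x` performed when the lamplighter stands at `x`; summed over `x`, the error is a
single variance of the position, which Poincaré's inequality controls. -/
lemma ent_lamp_le (hG : G.Connected) {f : V × (V → Bool) → ℝ} (hf : ∀ x, 0 < f x) :
    ent (lampLaw G) f ≤ 16 * ((∑ j, (G.degree j : ℝ)) / gap G) *
      dirichletForm (lampGen G) (lampLaw G) f (fun x => Real.log (f x)) := by
  set S := ∑ j, (G.degree j : ℝ) with hS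
  have hSpos : 0 < S := sum_degree_pos hG
  set γ := gap G with hγ
  have hγpos : 0 < γ := gap_pos hG
  have hγ2 : γ ≤ 2 := gap_le_two hG
  have Hw := walk_isIrreducibleReversible hG
  have Hl := lamp_isIrreducibleReversible hG
  have hπ := Hw.prob_nonneg
  have hc : ∀ σ, 0 ≤ coin V σ := fun σ => (coin_pos σ).le
  set g : V × (V → Bool) → ℝ := fun x => √(f x) with hg
  have hgpos : ∀ x, 0 < g x := fun x => Real.sqrt_pos.2 (hf x)
  have hgsq : ∀ x, g x ^ 2 = f x := fun x => Real.sq_sqrt (hf x).le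
  set F : (V → Bool) → ℝ := fun σ => expect (walkLaw G) (fun i => f (i, σ)) with hF
  have hFpos : ∀ σ, 0 < F σ := fun σ =>
    Finset.sum_pos (fun i _ => mul_pos (Hw.prob_pos i) (hf _)) Finset.univ_nonempty
  set Wk := expect (coin V) (fun σ => dirichletForm (walkGen G) (walkLaw G)
        (fun i => g (i, σ)) (fun i => g (i, σ))) with hWk
  set Φ := expect (coin V) (fun σ => expect (walkLaw G)
        (fun i => (g (i, flip σ i) - g (i, σ)) ^ 2)) with hΦ
  set Var := expect (coin V) (fun σ => expect (walkLaw G)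
        (fun i => (g (i, σ) - expect (walkLaw G) (fun i => g (i, σ))) ^ 2)) with hVar
  have hWk0 : 0 ≤ Wk := expect_nonneg hc fun σ => dirichletForm_self_nonneg Hw.rate_nonneg hπ _
  have hΦ0 : 0 ≤ Φ := expect_nonneg hc fun σ => expect_nonneg hπ fun i => sq_nonneg _
  have hVarWk : Var ≤ Wk / γ := by
    rw [le_div_iff₀ hγpos, mul_comm, hVar, ← expect_smul]
    exact expect_mono hc fun σ => poincare Hw _
  -- chain rule
  have chain : ent (lampLaw G) f =
      expect (coin V) (fun σ => ent (walkLaw G) (fun i => f (i, σ))) + ent (coin V) F := by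
    simp only [ent, expect_lampLaw]
    rw [expect_sub, expect_comm, expect_comm (walkLaw G) (coin V) (fun i σ => f (i, σ))]
    ring
  have pos : expect (coin V) (fun σ => ent (walkLaw G) (fun i => f (i, σ))) ≤ 4 * S * Var := by
    rw [hVar, ← expect_smul]
    refine expect_mono hc fun σ => ?_
    have := ent_sq_le (one_div_pos.2 hSpos) (one_div_sum_degree_le_walkLaw hG) Hw.prob_sum
      (fun i => hgpos (i, σ))
    simp only [hgsq] at this
    refine this.trans (le_of_eq ?_)
    field_simp
  have dev : expect (coin V) (fun σ => expect (walkLaw G) (fun i => (g (i, σ) - √(F σ)) ^ 2)) ≤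
      2 * Var := by
    rw [hVar, ← expect_smul]
    refine expect_mono hc fun σ => ?_
    have := expect_sub_sqrt_sq_le hπ Hw.prob_sum (fun i => (hgpos (i, σ)).le)
    simpa only [hgsq] using this
  have lamps : ent (coin V) F ≤ S * (3 * (4 * Var + Φ)) := by
    refine (ent_coin_le_of_invariant Finset.univ F hFpos
      (fun x hx => absurd (Finset.mem_univ x) hx)).trans ?_
    have h1 : ∀ x, expect (coin V) (fun σ => (√(F σ) - √(F (flip σ x))) ^ 2) ≤
        S * (walkLaw G x * (3 * (2 * expect (coin V) (fun σ => (g (x, σ) - √(F σ)) ^ 2) +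
          expect (coin V) (fun σ => (g (x, flip σ x) - g (x, σ)) ^ 2)))) := by
      intro x
      have h2 : expect (coin V) (fun σ => (√(F σ) - √(F (flip σ x))) ^ 2) ≤
          3 * (2 * expect (coin V) (fun σ => (g (x, σ) - √(F σ)) ^ 2) +
          expect (coin V) (fun σ => (g (x, flip σ x) - g (x, σ)) ^ 2)) := by
        have e : 2 * expect (coin V) (fun σ => (g (x, σ) - √(F σ)) ^ 2) =
            expect (coin V) (fun σ => (g (x, σ) - √(F σ)) ^ 2) +
            expect (coin V) (fun σ => (g (x, flip σ x) - √(F (flip σ x))) ^ 2) := by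
          rw [expect_coin_flip (fun σ => (g (x, σ) - √(F σ)) ^ 2) x]
          ring
        rw [e, ← expect_add, ← expect_add, ← expect_smul]
        refine expect_mono hc fun σ => ?_
        generalize √(F σ) = a
        generalize √(F (flip σ x)) = b
        generalize g (x, σ) = c
        generalize g (x, flip σ x) = d
        nlinarith [sq_nonneg ((c - a) + (d - b)), sq_nonneg ((c - a) - (d - c)),
          sq_nonneg ((d - b) + (d - c))]
      have h3 : 1 ≤ S * walkLaw G x := by
        have := one_div_sum_degree_le_walkLaw hG x
        rwa [div_le_iff₀' hSpos] at this
      have h4 : 0 ≤ expect (coin V) (fun σ => (√(F σ) - √(F (flip σ x))) ^ 2) :=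
        expect_nonneg hc fun σ => sq_nonneg _
      rw [← mul_assoc]
      nlinarith
    refine (Finset.sum_le_sum fun x _ => h1 x).trans ?_
    rw [← Finset.mul_sum]
    refine mul_le_mul_of_nonneg_left ?_ hSpos.le
    change expect (walkLaw G) (fun x => 3 * (2 * expect (coin V) (fun σ => (g (x, σ) - √(F σ)) ^ 2)
      + expect (coin V) (fun σ => (g (x, flip σ x) - g (x, σ)) ^ 2))) ≤ _
    rw [expect_smul, expect_add, expect_smul, expect_comm, expect_comm (walkLaw G)]
    linarith
  have split := lamp_dirichletForm_self (G := G) g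
  rw [← hΦ, ← hWk] at split
  have comp : 2 * dirichletForm (lampGen G) (lampLaw G) g g ≤
      dirichletForm (lampGen G) (lampLaw G) f (fun x => Real.log (f x)) := by
    have h := dirichletForm_mono (f := fun x => 2 * g x) (g := g) (f' := f)
      (g' := fun x => Real.log (f x)) Hl.rate_nonneg Hl.prob_nonneg (fun x y _ => by
        have := two_mul_sqrt_sub_sq_le (hf x) (hf y)
        simp only [hg]
        linarith)
    rwa [dirichletForm_smul_left] at h
  have fin : ent (lampLaw G) f ≤ 32 * (S / γ) * dirichletForm (lampGen G) (lampLaw G) g g := by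
    rw [chain, split]
    have h5 : ent (coin V) F + expect (coin V) (fun σ => ent (walkLaw G) (fun i => f (i, σ))) ≤
        S * (16 * (Wk / γ) + 3 * Φ) := by nlinarith
    have h6 : Φ ≤ 2 * (Φ / γ) := by
      rw [← mul_div_assoc, le_div_iff₀ hγpos]
      nlinarith
    have h7 : 0 ≤ Φ / γ := by positivity
    have h8 : 32 * (S / γ) * (1 / 4 * Φ + 1 / 2 * Wk) =
        S * (16 * (Wk / γ) + 8 * (Φ / γ)) := by field_simp; ring
    rw [h8]
    nlinarith
  calc _ ≤ _ := fin
    _ = 16 * (S / γ) * (2 * dirichletForm (lampGen G) (lampLaw G) g g) := by ring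
    _ ≤ _ := mul_le_mul_of_nonneg_left comp (by positivity)

end Lamplighter

namespace MarkovChain

/-! ### Resolvents -/

section Resolvent

variable {X : Type*} [Fintype X] {Q : Matrix X X ℝ} {π : X → ℝ}

/-- Minimum principle for `1 - θ Q`. -/
lemma nonneg_of_resolvent_nonneg (H : IsIrreducibleReversible Q π) {θ : ℝ} (hθ : 0 ≤ θ)
    {D : X → ℝ} (hD : ∀ x, 0 ≤ D x - θ * ∑ y, Q x y * D y) (x : X) : 0 ≤ D x := by
  have : Nonempty X := ⟨x⟩
  obtain ⟨z, -, hz⟩ := Finset.exists_min_image Finset.univ D Finset.univ_nonempty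
  refine le_trans ?_ (hz x (Finset.mem_univ x))
  have h : 0 ≤ ∑ y, Q z y * D y := by
    have e : ∑ y, Q z y * D y = ∑ y, Q z y * (D y - D z) := by
      simp only [mul_sub, Finset.sum_sub_distrib, ← Finset.sum_mul, H.row_sum z]
      ring
    rw [e]
    refine Finset.sum_nonneg fun y _ => ?_
    rcases eq_or_ne z y with rfl | hne
    · simp
    · exact mul_nonneg (H.rate_nonneg z y hne) (sub_nonneg.2 (hz y (Finset.mem_univ y)))
  have := hD z
  have := mul_nonneg hθ h
  linarith

lemma exists_resolvent (H : IsIrreducibleReversible Q π) {θ : ℝ} (hθ : 0 ≤ θ) (f : X → ℝ) :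
    ∃ F : X → ℝ, ∀ x, F x - θ * ∑ y, Q x y * F y = f x := by
  let L : (X → ℝ) →ₗ[ℝ] (X → ℝ) := LinearMap.id - θ • Q.mulVecLin
  have hL : ∀ F x, L F x = F x - θ * ∑ y, Q x y * F y := fun F x => by
    simp [L, Matrix.mulVec, dotProduct]
  have inj : Function.Injective L := by
    rw [← LinearMap.ker_eq_bot, LinearMap.ker_eq_bot']
    intro F hF
    ext x
    have h1 := nonneg_of_resolvent_nonneg H hθ (D := F)
      (fun x => by rw [← hL, hF]; simp) x
    have h2 := nonneg_of_resolvent_nonneg H hθ (D := -F)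
      (fun x => by rw [← hL, map_neg, hF]; simp) x
    simp only [Pi.neg_apply] at h2
    exact le_antisymm (show F x ≤ 0 by linarith) h1
  obtain ⟨F, hF⟩ := LinearMap.injective_iff_surjective.1 inj f
  exact ⟨F, fun x => by rw [← hL, hF]⟩

/-- Regularisation of a square by the resolvent at `θ = 1/4`: the resolvent `F` of `g²` has bounded
ratios along jumps, so that `ℰ(F, log F)` is comparable with `ℰ(√F, √F)`; and the latter is
comparable with `ℰ(g, g)` because `√F` stays `L²`-close to `g`. -/
lemma exists_regularised (H : IsIrreducibleReversible Q π) (hd : ∀ x, -1 ≤ Q x x) {b : ℝ}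
    (hb : 0 < b) (hb1 : b ≤ 1) (hQb : ∀ x y, 0 < Q x y → b ≤ Q x y) {g : X → ℝ}
    (hg : ∀ x, 0 ≤ g x) (hg0 : g ≠ 0) :
    ∃ F : X → ℝ, (∀ x, 0 < F x) ∧ (∀ x, F x - 1 / 4 * ∑ y, Q x y * F y = g x ^ 2) ∧
      expect π F = expect π (fun x => g x ^ 2) ∧
      dirichletForm Q π F (fun x => Real.log (F x)) ≤ 80 / b * dirichletForm Q π g g := by
  obtain ⟨F, hF⟩ := exists_resolvent H (θ := 1 / 4) (by norm_num) (fun x => g x ^ 2)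
  obtain ⟨k, hk⟩ := exists_resolvent H (θ := 1 / 4) (by norm_num) g
  have hF0 : ∀ x, 0 ≤ F x := nonneg_of_resolvent_nonneg H (θ := 1 / 4) (by norm_num)
    (fun x => by rw [hF]; exact sq_nonneg _)
  have hE : expect π F = expect π (fun x => g x ^ 2) := by
    have h := H.expect_gen F
    have h2 : expect π (fun x => F x - 1 / 4 * ∑ y, Q x y * F y) = expect π (fun x => g x ^ 2) := by
      simp only [hF]
    rw [expect_sub, expect_smul, h] at h2
    linarith
  have ratio : ∀ x y, 0 < Q x y → F y ≤ 5 / b * F x := by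
    intro x y hxy
    have hne : x ≠ y := by
      rintro rfl
      have := H.row_sum x
      classical
      rw [← Finset.add_sum_erase _ _ (Finset.mem_univ x)] at this
      have h2 : 0 ≤ ∑ y ∈ Finset.univ.erase x, Q x y := Finset.sum_nonneg fun y hy =>
        H.rate_nonneg x y (Finset.ne_of_mem_erase hy).symm
      linarith
    have h1 := hF x
    classical
    rw [← Finset.add_sum_erase _ _ (Finset.mem_univ x)] at h1
    have h2 : Q x y * F y ≤ ∑ y ∈ Finset.univ.erase x, Q x y * F y :=
      Finset.single_le_sum (f := fun y => Q x y * F y)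
        (fun z hz => mul_nonneg (H.rate_nonneg x z (Finset.ne_of_mem_erase hz).symm) (hF0 z))
        (Finset.mem_erase.2 ⟨hne.symm, Finset.mem_univ y⟩)
    have h3 : b * F y ≤ Q x y * F y := mul_le_mul_of_nonneg_right (hQb x y hxy) (hF0 y)
    have h4 : -1 * F x ≤ Q x x * F x := mul_le_mul_of_nonneg_right (hd x) (hF0 x)
    rw [div_mul_eq_mul_div, le_div_iff₀ hb]
    nlinarith [sq_nonneg (g x)]
  have sym : ∀ x y, 0 < Q x y → 0 < Q y x := by
    intro x y hxy
    have h := H.reversible x y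
    have h1 : 0 < π x * Q x y := mul_pos (H.prob_pos x) hxy
    rw [h] at h1
    exact pos_of_mul_pos_right h1 (H.prob_nonneg y)
  have hFpos : ∀ x, 0 < F x := by
    by_contra! h
    obtain ⟨x, hx⟩ := h
    have hx0 : F x = 0 := le_antisymm hx (hF0 x)
    have all : ∀ y, F y = 0 := by
      intro y
      have key := H.irreducible x y
      induction key with
      | refl => exact hx0
      | tail _ hbc ih =>
        have := ratio _ _ hbc
        rw [ih, mul_zero] at this
        exact le_antisymm this (hF0 _)
    apply hg0
    ext y
    have := hF y
    simp only [all, mul_zero, Finset.sum_const_zero, sub_zero] at this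
    exact pow_eq_zero_iff two_ne_zero |>.1 this.symm
  have hkF : ∀ x, k x ^ 2 ≤ F x := by
    intro x
    have := nonneg_of_resolvent_nonneg H (θ := 1 / 4) (by norm_num) (D := fun x => F x - k x ^ 2)
      (fun x => by
        -- `Q(k²) ≥ 2 k Q k` by convexity
        have h1 : 2 * k x * ∑ y, Q x y * k y ≤ ∑ y, Q x y * k y ^ 2 := by
          have e : ∑ y, Q x y * k y ^ 2 - 2 * k x * ∑ y, Q x y * k y =
              ∑ y, Q x y * (k y - k x) ^ 2 := by
            have r : ∑ y, Q x y * k x ^ 2 = 0 := by rw [← Finset.sum_mul, H.row_sum, zero_mul]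
            rw [Finset.mul_sum, ← sub_zero (∑ y, Q x y * k y ^ 2 - _), ← neg_zero, ← r,
              ← Finset.sum_sub_distrib, sub_neg_eq_add, ← Finset.sum_add_distrib]
            exact Finset.sum_congr rfl fun y _ => by ring
          have : 0 ≤ ∑ y, Q x y * (k y - k x) ^ 2 := by
            refine Finset.sum_nonneg fun y _ => ?_
            rcases eq_or_ne x y with rfl | hne
            · simp
            · exact mul_nonneg (H.rate_nonneg x y hne) (sq_nonneg _)
          linarith
        have h2 := hF x
        have h3 := hk x
        simp only [mul_sub, Finset.sum_sub_distrib]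
        have h4 : k x - g x = 1 / 4 * ∑ y, Q x y * k y := by linarith
        have h5 : 2 * k x * (k x - g x) ≤ 1 / 4 * ∑ y, Q x y * k y ^ 2 := by
          rw [h4]
          linarith
        nlinarith [sq_nonneg (g x - k x)]) x
    simpa using this
  have hgk : expect π (fun x => g x * (g x - k x)) = 1 / 4 * dirichletForm Q π g k := by
    rw [H.dirichletForm_eq, mul_neg, ← expect_smul]
    simp only [expect, ← Finset.sum_neg_distrib]
    refine Finset.sum_congr rfl fun x _ => ?_
    linear_combination (-π x * g x) * hk x
  have hEk : dirichletForm Q π g k ≤ dirichletForm Q π g g := by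
    have h1 : dirichletForm Q π (fun x => g x - k x) k =
        4 * expect π (fun x => (g x - k x) ^ 2) := by
      rw [H.dirichletForm_eq, ← expect_smul]
      simp only [expect, ← Finset.sum_neg_distrib]
      refine Finset.sum_congr rfl fun x _ => ?_
      linear_combination (4 * π x * (g x - k x)) * hk x
    have h2 := dirichletForm_self_nonneg H.rate_nonneg H.prob_nonneg (fun x => g x - k x)
    have h3 : 0 ≤ expect π (fun x => (g x - k x) ^ 2) :=
      expect_nonneg H.prob_nonneg fun x => sq_nonneg _
    rw [dirichletForm_sub_left] at h1 h2
    rw [dirichletForm_comm Q π g, dirichletForm_comm Q π k, dirichletForm_sub_left,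
      dirichletForm_sub_left, dirichletForm_comm Q π k g] at h2
    linarith
  have hclose : expect π (fun x => (√(F x) - g x) ^ 2) ≤ 1 / 2 * dirichletForm Q π g g := by
    have h1 : expect π (fun x => (√(F x) - g x) ^ 2) ≤
        expect π (fun x => (F x - g x ^ 2) + 2 * (g x * (g x - k x))) := by
      refine expect_mono H.prob_nonneg fun x => ?_
      have h2 := Real.sq_sqrt (hF0 x)
      have h3 : k x ≤ √(F x) := Real.le_sqrt_of_sq_le (hkF x)
      nlinarith [mul_nonneg (hg x) (sub_nonneg.2 h3)]
    rw [expect_add, expect_sub, hE, expect_smul, hgk] at h1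
    linarith
  have hsq : dirichletForm Q π (fun x => √(F x)) (fun x => √(F x)) ≤ 4 * dirichletForm Q π g g := by
    have h1 := dirichletForm_self_le H hd (fun x => √(F x) - g x)
    have h2 : dirichletForm Q π (fun x => √(F x)) (fun x => √(F x)) ≤
        2 * dirichletForm Q π g g +
          2 * dirichletForm Q π (fun x => √(F x) - g x) (fun x => √(F x) - g x) := by
      rw [← dirichletForm_smul_left, ← dirichletForm_smul_left]
      have h3 := dirichletForm_self_nonneg H.rate_nonneg H.prob_nonneg
        (fun x => 2 * g x - √(F x))
      have e : ∀ a c : X → ℝ, dirichletForm Q π (fun x => a x - c x) (fun x => a x - c x) =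
          dirichletForm Q π a a - 2 * dirichletForm Q π a c + dirichletForm Q π c c := by
        intro a c
        rw [dirichletForm_sub_left, dirichletForm_comm Q π a, dirichletForm_comm Q π c,
          dirichletForm_sub_left, dirichletForm_sub_left, dirichletForm_comm Q π c a]
        ring
      rw [dirichletForm_smul_left, dirichletForm_smul_left, e,
        dirichletForm_comm Q π (fun x => √(F x)) g]
      rw [e (fun x => 2 * g x), dirichletForm_smul_left, dirichletForm_smul_left,
        dirichletForm_comm Q π g (fun x => 2 * g x), dirichletForm_smul_left,
        dirichletForm_comm Q π g] at h3
      linarith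
    linarith
  refine ⟨F, hFpos, hF, hE, ?_⟩
  have h5 : 1 ≤ 5 / b := by
    rw [le_div_iff₀ hb]
    linarith
  have h := dirichletForm_mono (f := F) (g := fun x => Real.log (F x))
    (f' := fun x => 4 * (5 / b) * √(F x)) (g' := fun x => √(F x)) H.rate_nonneg H.prob_nonneg
    (fun x y hxy => by
      have := sub_mul_log_sub_le (hFpos x) (hFpos y) h5 (ratio y x (sym x y hxy)) (ratio x y hxy)
      linarith)
  rw [dirichletForm_smul_left] at h
  calc _ ≤ _ := h
    _ ≤ 4 * (5 / b) * (4 * dirichletForm Q π g g) := mul_le_mul_of_nonneg_left hsq (by positivity)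
    _ = _ := by ring

/-- The Gibbs variational lower bound for the entropy. -/
lemma gibbs_le_ent (hπ : ∀ x, 0 < π x) [Nonempty X] {F : X → ℝ} (hF : ∀ x, 0 < F x)
    (ψ : X → ℝ) :
    expect π (fun x => F x * ψ x) ≤
      ent π F + expect π F * Real.log (expect π (fun x => Real.exp (ψ x))) := by
  set M := expect π F with hM
  set Z := expect π (fun x => Real.exp (ψ x)) with hZ
  have hM0 : 0 < M := Finset.sum_pos (fun x _ => mul_pos (hπ x) (hF x)) Finset.univ_nonempty
  have hZ0 : 0 < Z :=
    Finset.sum_pos (fun x _ => mul_pos (hπ x) (Real.exp_pos _)) Finset.univ_nonempty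
  have key : expect π (fun x => F x * ψ x) ≤ expect π (fun x =>
      (F x * Real.log (F x) - (Real.log M - Real.log Z) * F x) +
        (M / Z * Real.exp (ψ x) - F x)) := by
    refine expect_mono (fun x => (hπ x).le) fun x => ?_
    have h := mul_le_mul_of_nonneg_left (Real.log_le_sub_one_of_pos
      (show 0 < Real.exp (ψ x) * M / (Z * F x) by have := hF x; positivity)) (hF x).le
    have h1 := hF x
    rw [Real.log_div (by positivity) (by positivity), Real.log_mul (by positivity) hM0.ne',
      Real.log_mul hZ0.ne' h1.ne', Real.log_exp] at h
    have e : F x * (Real.exp (ψ x) * M / (Z * F x) - 1) = M / Z * Real.exp (ψ x) - F x := by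
      field_simp
    rw [e] at h
    linarith
  rw [expect_add, expect_sub, expect_sub, expect_smul, expect_smul, ← hM, ← hZ,
    div_mul_cancel₀ _ hZ0.ne'] at key
  rw [ent, ← hM]
  linarith

end Resolvent

end MarkovChain

namespace Lamplighter

open MarkovChain

variable {V : Type*} [Fintype V] [DecidableEq V]

/-! ### Lower bound for the modified log-Sobolev constant -/

/-- The number of lamps of `A` that are lit. -/
def lit (A : Finset V) (σ : V → Bool) : ℝ := ∑ x ∈ A, if σ x then 1 else 0

lemma lit_flip_sub_le (A : Finset V) (σ : V → Bool) (i : V) : lit A (flip σ i) - lit A σ ≤ 1 := by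
  unfold lit
  rw [← Finset.sum_sub_distrib]
  calc _ ≤ ∑ x ∈ A, (if x = i then (1 : ℝ) else 0) := by
        refine Finset.sum_le_sum fun x _ => ?_
        by_cases h : x = i
        · rw [if_pos h]
          split_ifs <;> norm_num
        · rw [if_neg h, flip_of_ne _ h, sub_self]
    _ ≤ 1 := by
        rw [Finset.sum_ite_eq']
        split_ifs <;> norm_num

lemma expect_exp_neg_lit (A : Finset V) :
    expect (coin V) (fun σ => Real.exp (-lit A σ)) = ((1 + Real.exp (-1)) / 2) ^ A.card := by
  have h1 : ∀ σ : V → Bool, coin V σ * Real.exp (-lit A σ) =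
      ∏ x, (if x ∈ A then (if σ x then Real.exp (-1) / 2 else 1 / 2) else 1 / 2) := by
    intro σ
    have e1 : coin V σ = ∏ _x : V, (1 / 2 : ℝ) := by simp [coin]
    have e2 : Real.exp (-lit A σ) =
        ∏ x, (if x ∈ A then (if σ x then Real.exp (-1) else 1) else 1) := by
      rw [lit, ← Finset.sum_neg_distrib, Real.exp_sum, Finset.prod_ite_mem, Finset.univ_inter]
      refine Finset.prod_congr rfl fun x _ => ?_
      split_ifs <;> simp
    rw [e1, e2, ← Finset.prod_mul_distrib]
    refine Finset.prod_congr rfl fun x _ => ?_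
    split_ifs <;> ring
  have h2 := Finset.prod_univ_sum (fun _ : V => (Finset.univ : Finset Bool))
    (fun x (b : Bool) => if x ∈ A then (if b then Real.exp (-1) / 2 else 1 / 2) else (1 / 2 : ℝ))
  rw [Fintype.piFinset_univ] at h2
  unfold expect
  simp only [h1]
  rw [← h2]
  have h3 : ∀ x : V, ∑ b : Bool, (if x ∈ A then (if b then Real.exp (-1) / 2 else 1 / 2)
      else (1 / 2 : ℝ)) = if x ∈ A then (1 + Real.exp (-1)) / 2 else 1 := by
    intro x
    by_cases h : x ∈ A
    · simp only [h, if_true, Fintype.sum_bool, Bool.false_eq_true, if_false]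
      ring
    · simp only [h, if_false, Fintype.sum_bool]
      norm_num
  simp only [h3]
  rw [Finset.prod_ite_mem, Finset.univ_inter, Finset.prod_const]

variable {G : SimpleGraph V} [DecidableRel G.Adj] [Nontrivial V]

/-- There is a nonzero nonnegative function, vanishing on at least half of the vertices, whose
Rayleigh quotient is at most the spectral gap: the positive part of an eigenfunction, with the sign
suitably chosen. -/
lemma exists_truncated_eigenfunction (hG : G.Connected) :
    ∃ (h : V → ℝ) (A : Finset V), h ≠ 0 ∧ (∀ i, 0 ≤ h i) ∧ (∀ i ∈ A, h i = 0) ∧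
      Fintype.card V ≤ 2 * A.card ∧
      dirichletForm (walkGen G) (walkLaw G) h h ≤
        gap G * expect (walkLaw G) (fun i => h i ^ 2) := by
  have H := walk_isIrreducibleReversible hG
  obtain ⟨φ₀, hφ₀, hm₀, he₀⟩ := (spectralGap_spec H).2.1
  obtain ⟨φ, hφ, hm, he, hcard⟩ : ∃ φ : V → ℝ, φ ≠ 0 ∧ expect (walkLaw G) φ = 0 ∧
      -((walkGen G).mulVec φ) = gap G • φ ∧
      Fintype.card V ≤ 2 * (Finset.univ.filter fun i => φ i ≤ 0).card := by
    have hc : Fintype.card V ≤ (Finset.univ.filter fun i => φ₀ i ≤ 0).card +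
        (Finset.univ.filter fun i => -φ₀ i ≤ 0).card := by
      rw [← Finset.card_univ]
      refine le_trans (Finset.card_le_card fun i _ => ?_) (Finset.card_union_le _ _)
      simp only [Finset.mem_union, Finset.mem_filter, Finset.mem_univ, true_and, Left.neg_nonpos_iff]
      exact le_total _ _
    rcases le_total (Finset.univ.filter fun i => φ₀ i ≤ 0).card
      (Finset.univ.filter fun i => -φ₀ i ≤ 0).card with h | h
    · refine ⟨-φ₀, neg_ne_zero.2 hφ₀, ?_, ?_, ?_⟩
      · simpa [expect] using hm₀
      · rw [Matrix.mulVec_neg, he₀, smul_neg]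
        rfl
      · simp only [Pi.neg_apply]
        omega
    · exact ⟨φ₀, hφ₀, hm₀, he₀, by omega⟩
  refine ⟨fun i => max (φ i) 0, Finset.univ.filter fun i => φ i ≤ 0, ?_, fun i => le_max_right _ _,
    fun i hi => max_eq_right (by simpa using hi), hcard, ?_⟩
  · intro h0
    apply hφ
    have hle : ∀ i, 0 ≤ -φ i := fun i => by
      have := congrFun h0 i
      have := le_max_left (φ i) 0
      simp_all
    have hz := eq_zero_of_expect_eq_zero H.prob_pos hle (by simpa [expect] using hm)
    ext i
    simpa using hz i
  · calc _ ≤ dirichletForm (walkGen G) (walkLaw G) (fun i => max (φ i) 0) φ := by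
          refine dirichletForm_mono H.rate_nonneg H.prob_nonneg fun x y _ => ?_
          rcases le_total (φ x) 0 with h1 | h1 <;> rcases le_total (φ y) 0 with h2 | h2 <;>
            simp only [max_eq_left, max_eq_right, h1, h2] <;> nlinarith
      _ = gap G * expect (walkLaw G) (fun i => max (φ i) 0 * φ i) := isEigen_rayleigh H he _
      _ = _ := by
          congr 2
          ext i
          rcases le_total (φ i) 0 with h1 | h1 <;> simp [h1, pow_two]

/-- Every admissible constant in the modified log-Sobolev inequality is of order at least
`|V| / γ(G)`. The test function is the regularised density of a lamplighter whose position follows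
`h²`, with `h` a truncated eigenfunction, and whose lamps in the zero set `A` of `h` are all off:
its entropy is of order `|A|`, while only the moves of the walk contribute to `ℰ`. -/
lemma card_div_gap_le (hG : G.Connected) {D : ℕ} (hD : ∀ i, G.degree i ≤ D) {t : ℝ}
    (ht : ∀ f : V × (V → Bool) → ℝ, (∀ x, 0 < f x) → ent (lampLaw G) f ≤
      t * dirichletForm (lampGen G) (lampLaw G) f (fun x => Real.log (f x))) (ht0 : 0 ≤ t) :
    1 / (1280 * (D : ℝ)) * ((Fintype.card V : ℝ) / gap G) ≤ t := by
  have Hw := walk_isIrreducibleReversible hG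
  have Hl := lamp_isIrreducibleReversible hG
  have hγ := gap_pos hG
  obtain ⟨h, A, hh0, hhn, hhA, hcard, hray⟩ := exists_truncated_eigenfunction hG
  have hD1 : (1 : ℝ) ≤ D := by
    obtain ⟨i⟩ : Nonempty V := inferInstance
    have h1 := hG.preconnected.degree_pos_of_nontrivial i
    exact_mod_cast h1.trans_le (hD i)
  let off : (V → Bool) → ℝ := fun σ => if ∀ x ∈ A, σ x = false then 1 else 0
  let g : V × (V → Bool) → ℝ := fun x => h x.1 * off x.2
  have hoff : ∀ σ, 0 ≤ off σ := fun σ => by simp only [off]; split_ifs <;> norm_num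
  have hg : ∀ x, 0 ≤ g x := fun x => mul_nonneg (hhn _) (hoff _)
  have hg0 : g ≠ 0 := by
    intro hg0
    apply hh0
    ext i
    have := congrFun hg0 (i, fun _ => false)
    simpa [g, off] using this
  have hflip : ∀ i σ, g (i, flip σ i) = g (i, σ) := by
    intro i σ
    by_cases hi : i ∈ A
    · simp [g, hhA i hi]
    · have : off (flip σ i) = off σ := by
        simp only [off]
        congr 1
        refine propext (forall₂_congr fun x hx => ?_)
        rw [flip_of_ne]
        rintro rfl
        exact hi hx
      simp only [g, this]
  have hEg : dirichletForm (lampGen G) (lampLaw G) g g ≤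
      1 / 2 * gap G * expect (lampLaw G) (fun x => g x ^ 2) := by
    have h1 : expect (lampLaw G) (fun x => g x ^ 2) =
        expect (coin V) (fun σ => expect (walkLaw G) (fun i => h i ^ 2) * off σ ^ 2) := by
      rw [expect_lampLaw, expect_comm]
      congr 1
      ext σ
      rw [mul_comm, ← expect_smul]
      congr 1
      ext i
      simp only [g]
      ring
    rw [lamp_dirichletForm_self, h1]
    simp only [hflip, sub_self, ne_eq, OfNat.ofNat_ne_zero, not_false_eq_true, zero_pow]
    have z : expect (coin V) (fun _ => expect (walkLaw G) (fun _ => 0)) = 0 := by simp [expect]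
    rw [z, mul_zero, zero_add, mul_assoc, ← expect_smul _ (gap G)]
    refine mul_le_mul_of_nonneg_left (expect_mono (fun σ => (coin_pos σ).le) fun σ => ?_)
      (by norm_num)
    have e : dirichletForm (walkGen G) (walkLaw G) (fun i => g (i, σ)) (fun i => g (i, σ)) =
        off σ ^ 2 * dirichletForm (walkGen G) (walkLaw G) h h := by
      have : (fun i => g (i, σ)) = fun i => off σ * h i := funext fun i => mul_comm _ _
      rw [this, dirichletForm_smul_left, dirichletForm_comm, dirichletForm_smul_left]
      ring
    rw [e]
    nlinarith [sq_nonneg (off σ)]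
  have hb : (0 : ℝ) < 1 / (2 * D) := by positivity
  have hb1 : (1 : ℝ) / (2 * D) ≤ 1 / 2 := by
    rw [div_le_div_iff₀ (by positivity) (by positivity)]
    linarith
  obtain ⟨F, hFpos, hF, hEF, hFlog⟩ := exists_regularised Hl (fun x => (lampGen_diag hG x).ge)
    hb (by linarith) (fun x y hxy => by
      have hne : x ≠ y := by
        rintro rfl
        rw [lampGen_diag hG] at hxy
        linarith
      rw [lampGen_apply G hne] at hxy ⊢
      have d1 := degree_pos hG x.1
      have d2 : (G.degree x.1 : ℝ) ≤ D := by exact_mod_cast hD x.1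
      have d3 : (1 : ℝ) / (2 * D) ≤ 1 / (2 * G.degree x.1) :=
        one_div_le_one_div_of_le (by positivity) (by linarith)
      have d4 : (0 : ℝ) < 1 / (2 * G.degree x.1) := by positivity
      split_ifs at hxy ⊢ <;> linarith) hg hg0
  have hM : 0 < expect (lampLaw G) F :=
    Finset.sum_pos (fun x _ => mul_pos (Hl.prob_pos x) (hFpos x)) Finset.univ_nonempty
  -- the number of lit lamps in `A` vanishes under `g²`, and is still small under `F`
  have hlit : expect (lampLaw G) (fun x => F x * lit A x.2) ≤ 1 / 8 * expect (lampLaw G) F := by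
    have h1 : expect (lampLaw G) (fun x => F x * lit A x.2) =
        expect (lampLaw G) (fun x => g x ^ 2 * lit A x.2) +
        1 / 4 * expect (lampLaw G) (fun x => lit A x.2 * ∑ y, lampGen G x y * F y) := by
      rw [← expect_smul, ← expect_add]
      congr 1
      ext x
      rw [← hF x]
      ring
    have h2 : expect (lampLaw G) (fun x => g x ^ 2 * lit A x.2) = 0 := by
      refine Finset.sum_eq_zero fun x _ => ?_
      by_cases hx : ∀ y ∈ A, x.2 y = false
      · have : lit A x.2 = 0 := Finset.sum_eq_zero fun y hy => by simp [hx y hy]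
        simp [this]
      · have : g x = 0 := by simp [g, off, hx]
        simp [this]
    have h3 : expect (lampLaw G) (fun x => lit A x.2 * ∑ y, lampGen G x y * F y) =
        expect (lampLaw G) (fun x => F x * ∑ y, lampGen G x y * lit A y.2) := by
      have e1 := Hl.dirichletForm_eq (fun x => lit A x.2) F
      have e2 := Hl.dirichletForm_eq F (fun x => lit A x.2)
      rw [dirichletForm_comm] at e1
      linarith
    have h4 : expect (lampLaw G) (fun x => F x * ∑ y, lampGen G x y * lit A y.2) ≤
        expect (lampLaw G) (fun x => 1 / 2 * F x) := by
      refine expect_mono Hl.prob_nonneg fun x => ?_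
      rw [lampGen_sum G (fun y => lit A y.2)]
      simp only [sub_self, Finset.sum_const_zero, mul_zero, add_zero]
      nlinarith [hFpos x, lit_flip_sub_le A x.2 x.1]
    rw [expect_smul] at h4
    rw [h1, h2, h3]
    linarith
  have hAcard : (1 : ℝ) ≤ A.card := by
    have : 0 < Fintype.card V := Fintype.card_pos
    exact_mod_cast (by omega : 1 ≤ A.card)
  have hent : expect (lampLaw G) F * (A.card / 8) ≤ ent (lampLaw G) F := by
    have h1 := gibbs_le_ent Hl.prob_pos hFpos (fun x => -lit A x.2)
    have h2 : expect (lampLaw G) (fun x => Real.exp (-lit A x.2)) =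
        ((1 + Real.exp (-1)) / 2) ^ A.card := by
      simp only [expect_lampLaw, expect_exp_neg_lit, expect_const (walkLaw_sum hG)]
    have h3 : expect (lampLaw G) (fun x => F x * -lit A x.2) =
        -expect (lampLaw G) (fun x => F x * lit A x.2) := by
      simp [expect]
    have h4 : Real.log ((1 + Real.exp (-1)) / 2) ≤ -(1 / 4) := by
      have h5 : Real.exp (-1) ≤ 1 / 2 := by
        rw [Real.exp_neg, inv_le_comm₀ (Real.exp_pos _) (by norm_num)]
        have := Real.exp_one_gt_d9
        norm_num
        linarith
      have := Real.log_le_sub_one_of_pos (show 0 < (1 + Real.exp (-1)) / 2 by positivity)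
      linarith
    rw [h2, h3, Real.log_pow] at h1
    have h6 : (A.card : ℝ) * Real.log ((1 + Real.exp (-1)) / 2) ≤ A.card * -(1 / 4) :=
      mul_le_mul_of_nonneg_left h4 (by positivity)
    nlinarith [mul_le_mul_of_nonneg_left h6 hM.le]
  have key := ht F hFpos
  have h7 : t * dirichletForm (lampGen G) (lampLaw G) F (fun x => Real.log (F x)) ≤
      t * (80 / (1 / (2 * D)) * (1 / 2 * gap G * expect (lampLaw G) F)) := by
    refine mul_le_mul_of_nonneg_left (hFlog.trans (mul_le_mul_of_nonneg_left ?_ (by positivity))) ht0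
    rw [hEF]
    exact hEg
  have h8 : expect (lampLaw G) F * (A.card / 8) ≤ expect (lampLaw G) F * (t * (80 * D * gap G)) := by
    refine (hent.trans (key.trans h7)).trans (le_of_eq ?_)
    field_simp
  have h9 := le_of_mul_le_mul_left h8 hM
  have h10 : (Fintype.card V : ℝ) ≤ 2 * A.card := by exact_mod_cast hcard
  rw [div_mul_div_comm, div_le_iff₀ (by positivity)]
  linarith

/-- Two-sided bound on the modified log-Sobolev constant in terms of `|V| / γ(G)`. -/
lemma tMLS_bounds (hG : G.Connected) {D : ℕ} (hD : ∀ i, G.degree i ≤ D) :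
    1 / (1280 * (D : ℝ)) * ((Fintype.card V : ℝ) / gap G) ≤ tMLS (lampGen G) (lampLaw G) ∧
    tMLS (lampGen G) (lampLaw G) ≤ 16 * (D : ℝ) * ((Fintype.card V : ℝ) / gap G) := by
  have hγ := gap_pos hG
  have Hl := lamp_isIrreducibleReversible hG
  have hmem : 16 * (D : ℝ) * ((Fintype.card V : ℝ) / gap G) ∈ {t : ℝ | 0 ≤ t ∧
      ∀ f : V × (V → Bool) → ℝ, (∀ x, 0 < f x) → ent (lampLaw G) f ≤
        t * dirichletForm (lampGen G) (lampLaw G) f (fun x => Real.log (f x))} := by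
    refine ⟨by positivity, fun f hf => (ent_lamp_le hG hf).trans ?_⟩
    refine mul_le_mul_of_nonneg_right ?_ ?_
    · have h1 : ∑ j, (G.degree j : ℝ) ≤ Fintype.card V * D := by
        calc _ ≤ ∑ _j : V, (D : ℝ) := Finset.sum_le_sum fun j _ => by exact_mod_cast hD j
          _ = _ := by simp
      have h2 : (∑ j, (G.degree j : ℝ)) / gap G ≤ Fintype.card V * D / gap G :=
        div_le_div_of_nonneg_right h1 hγ.le
      calc _ ≤ 16 * (Fintype.card V * D / gap G) := by linarith
        _ = _ := by ring
    · have := dirichletForm_mono (f := 0) (g := 0) (f' := f) (g' := fun x => Real.log (f x))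
        Hl.rate_nonneg Hl.prob_nonneg (fun x y _ => by
          have := two_mul_sqrt_sub_sq_le (hf x) (hf y)
          simp only [Pi.zero_apply, sub_self, mul_zero]
          nlinarith [mul_self_nonneg (√(f x) - √(f y))])
      simpa [dirichletForm] using this
  exact ⟨le_csInf ⟨_, hmem⟩ fun t ht => card_div_gap_le hG hD ht.2 ht.1,
    csInf_le ⟨0, fun t ht => ht.1⟩ hmem⟩

end Lamplighter

namespace MarkovChain

/-! ### The semigroup generated by a matrix -/

section Semigroup

attribute [local instance] Matrix.linftyOpNormedRing Matrix.linftyOpNormedAlgebra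

variable {m n : Type*} [Fintype m] [Fintype n] [DecidableEq m] [DecidableEq n]

lemma transition_hasSum (A : Matrix m m ℝ) (t : ℝ) :
    HasSum (fun k : ℕ => (k.factorial : ℝ)⁻¹ • (t • A) ^ k) (transition A t) :=
  NormedSpace.exp_series_hasSum_exp' (𝕂 := ℝ) (t • A)

@[simp] lemma transition_zero_gen (t : ℝ) : transition (0 : Matrix m m ℝ) t = 1 := by
  rw [transition, smul_zero, NormedSpace.exp_zero]

/-- Intertwined generators have intertwined semigroups. -/
lemma transition_mul_of_intertwine {A : Matrix m m ℝ} {B : Matrix n n ℝ} {Λ : Matrix m n ℝ}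
    (h : A * Λ = Λ * B) (t : ℝ) : transition A t * Λ = Λ * transition B t := by
  have hp : ∀ k : ℕ, (t • A) ^ k * Λ = Λ * (t • B) ^ k := by
    intro k
    induction k with
    | zero => simp
    | succ k ih =>
      rw [pow_succ, Matrix.mul_assoc, Matrix.smul_mul, h, ← Matrix.mul_smul, ← Matrix.mul_assoc, ih,
        Matrix.mul_assoc, ← pow_succ]
  have h1 := (transition_hasSum A t).map (Matrix.addMonoidHomMulRight Λ) (by
    change Continuous fun X : Matrix m m ℝ => X * Λ
    fun_prop)
  have h2 := (transition_hasSum B t).map (Matrix.addMonoidHomMulLeft Λ) (by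
    change Continuous fun X : Matrix n n ℝ => Λ * X
    fun_prop)
  refine h1.unique (h2.congr_fun fun k => ?_)
  change ((k.factorial : ℝ)⁻¹ • (t • A) ^ k) * Λ = Λ * ((k.factorial : ℝ)⁻¹ • (t • B) ^ k)
  rw [Matrix.smul_mul, hp, Matrix.mul_smul]

lemma transition_row_sum {A : Matrix m m ℝ} (h : ∀ x, ∑ y, A x y = 0) (t : ℝ) (x : m) :
    ∑ y, transition A t x y = 1 := by
  have h1 := transition_mul_of_intertwine (A := A) (B := (0 : Matrix Unit Unit ℝ))
    (Λ := Matrix.of fun _ _ => 1) (by ext x; simp [Matrix.mul_apply, h]) t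
  have h2 := congrFun (congrFun h1 x) ()
  simpa [Matrix.mul_apply] using h2

lemma transition_nonneg {A : Matrix m m ℝ} (h : ∀ x y, x ≠ y → 0 ≤ A x y) {t : ℝ} (ht : 0 ≤ t)
    (x y : m) : 0 ≤ transition A t x y := by
  set c : ℝ := ∑ x, |A x x| with hc
  set M : Matrix m m ℝ := A + c • 1 with hM
  have hM0 : ∀ x y, 0 ≤ M x y := by
    intro x y
    rcases eq_or_ne x y with rfl | hne
    · have : |A x x| ≤ c :=
        Finset.single_le_sum (f := fun x => |A x x|) (fun y _ => abs_nonneg _) (Finset.mem_univ x)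
      have := neg_abs_le (A x x)
      simp only [hM, Matrix.add_apply, Matrix.smul_apply, Matrix.one_apply_eq, smul_eq_mul, mul_one]
      linarith
    · simpa [hM, Matrix.one_apply_ne hne] using h x y hne
  have hp : ∀ (k : ℕ) x y, 0 ≤ ((t • M) ^ k) x y := by
    intro k
    induction k with
    | zero =>
      intro x y
      rw [pow_zero, Matrix.one_apply]
      split_ifs <;> norm_num
    | succ k ih =>
      intro x y
      rw [pow_succ, Matrix.mul_apply]
      exact Finset.sum_nonneg fun z _ => mul_nonneg (ih x z) (mul_nonneg ht (hM0 z y))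
  have hT : ∀ x y, 0 ≤ transition M t x y := by
    intro x y
    have h1 : HasSum (fun k : ℕ => ((k.factorial : ℝ)⁻¹ • (t • M) ^ k) x y) (transition M t x y) :=
      Pi.hasSum.1 (Pi.hasSum.1 (transition_hasSum M t) x) y
    refine h1.nonneg fun k => ?_
    rw [Matrix.smul_apply, smul_eq_mul]
    exact mul_nonneg (by positivity) (hp k x y)
  have e : transition A t = transition M t * algebraMap ℝ (Matrix m m ℝ) (Real.exp (-(c * t))) := by
    have e1 : t • A = t • M + algebraMap ℝ (Matrix m m ℝ) (-(c * t)) := by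
      rw [hM, Algebra.algebraMap_eq_smul_one, smul_add, smul_smul, add_assoc, ← add_smul]
      rw [show t * c + -(c * t) = 0 by ring, zero_smul, add_zero]
    rw [transition, e1, Real.exp_eq_exp_ℝ]
    rw [NormedSpace.algebraMap_exp_comm (𝕂 := ℝ) (𝔸 := Matrix m m ℝ)]
    exact NormedSpace.exp_add_of_commute (Algebra.commute_algebraMap_right _ _)
  rw [e, Algebra.algebraMap_eq_smul_one, Matrix.mul_smul, Matrix.mul_one, Matrix.smul_apply,
    smul_eq_mul]
  exact mul_nonneg (Real.exp_pos _).le (hT x y)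

lemma transition_mulVec_hasDerivAt (A : Matrix m m ℝ) (u : m → ℝ) (x : m) (t : ℝ) :
    HasDerivAt (fun t => (transition A t *ᵥ u) x) ((A *ᵥ (transition A t *ᵥ u)) x) t := by
  let ℓ : Matrix m m ℝ →ₗ[ℝ] ℝ :=
    { toFun := fun M => (M *ᵥ u) x
      map_add' := fun M N => by simp [Matrix.add_mulVec]
      map_smul' := fun c M => by simp [Matrix.smul_mulVec] }
  have h0 : HasDerivAt (fun t => transition A t) (A * transition A t) t :=
    hasDerivAt_exp_smul_const' (𝕂 := ℝ) A t
  have := (LinearMap.toContinuousLinearMap ℓ).hasFDerivAt.comp_hasDerivAt t h0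
  rw [Matrix.mulVec_mulVec]
  exact this

/-- Exponential `L²` decay along the semigroup of a dissipative generator. -/
lemma expect_transition_sq_le {A : Matrix m m ℝ} {π : m → ℝ} {l : ℝ} {u : m → ℝ}
    (h : ∀ t, l * expect π (fun x => (transition A t *ᵥ u) x ^ 2) ≤
      -expect π (fun x => (transition A t *ᵥ u) x * (A *ᵥ (transition A t *ᵥ u)) x))
    {t : ℝ} (ht : 0 ≤ t) :
    expect π (fun x => (transition A t *ᵥ u) x ^ 2) ≤
      Real.exp (-(2 * l * t)) * expect π (fun x => u x ^ 2) := by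
  set ψ : ℝ → ℝ := fun t => expect π (fun x => (transition A t *ᵥ u) x ^ 2) with hψ
  have hd : ∀ t, HasDerivAt ψ
      (2 * expect π (fun x => (transition A t *ᵥ u) x * (A *ᵥ (transition A t *ᵥ u)) x)) t := by
    intro t
    simp only [hψ, expect]
    rw [Finset.mul_sum]
    refine HasDerivAt.fun_sum fun x _ => ?_
    refine (((transition_mulVec_hasDerivAt A u x t).pow 2).const_mul (π x)).congr_deriv ?_
    simp only [Nat.cast_ofNat, Nat.add_one_sub_one, pow_one]
    ring
  have hd2 : ∀ t, HasDerivAt (fun t => Real.exp (2 * l * t) * ψ t)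
      (Real.exp (2 * l * t) * (2 * l) * ψ t + Real.exp (2 * l * t) *
        (2 * expect π (fun x => (transition A t *ᵥ u) x * (A *ᵥ (transition A t *ᵥ u)) x))) t := by
    intro t
    have h1 : HasDerivAt (fun t => Real.exp (2 * l * t)) (Real.exp (2 * l * t) * (2 * l)) t := by
      have := ((hasDerivAt_id t).const_mul (2 * l)).exp
      simpa using this
    exact h1.mul (hd t)
  have anti : Antitone fun t => Real.exp (2 * l * t) * ψ t := by
    refine antitone_of_hasDerivAt_nonpos hd2 fun t => ?_
    have := h t
    have h1 := (Real.exp_pos (2 * l * t)).le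
    simp only [hψ, Pi.zero_apply]
    nlinarith
  have h0 := anti ht
  have e0 : ψ 0 = expect π (fun x => u x ^ 2) := by
    simp only [hψ, transition, zero_smul, NormedSpace.exp_zero, Matrix.one_mulVec]
  simp only [mul_zero, Real.exp_zero, one_mul, e0] at h0
  rw [Real.exp_neg, inv_mul_eq_div, le_div_iff₀ (Real.exp_pos _)]
  linarith

end Semigroup

/-! ### Relative entropy and total variation -/

section Entropy

variable {X : Type*} [Fintype X]

/-- A weak form of Pinsker's inequality, through the Hellinger distance. -/
lemma tvDist_le_sqrt_relEntropy {μ π : X → ℝ} (hμ : ∀ x, 0 ≤ μ x) (hμ1 : ∑ x, μ x = 1)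
    (hπ : ∀ x, 0 < π x) (hπ1 : ∑ x, π x = 1) : tvDist μ π ≤ √(relEntropy μ π) := by
  have hel : ∑ x, (√(μ x) - √(π x)) ^ 2 ≤ relEntropy μ π := by
    have h1 : ∀ x, 2 * μ x - 2 * (√(μ x) * √(π x)) ≤ μ x * Real.log (μ x / π x) := by
      intro x
      rcases (hμ x).eq_or_lt with h0 | h0
      · simp [← h0]
      have a := Real.sqrt_pos.2 h0
      have b := Real.sqrt_pos.2 (hπ x)
      have a1 := Real.sq_sqrt h0.le
      have b1 := Real.sq_sqrt (hπ x).le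
      have h2 := Real.one_sub_inv_le_log_of_pos (div_pos a b)
      rw [inv_div] at h2
      have h3 : Real.log (μ x / π x) = 2 * Real.log (√(μ x) / √(π x)) := by
        rw [← a1, ← b1, ← div_pow, Real.log_pow, a1, b1]
        norm_num
      rw [h3]
      have h4 : μ x * (√(π x) / √(μ x)) = √(μ x) * √(π x) := by
        nth_rewrite 1 [← a1]
        field_simp
      nlinarith [mul_le_mul_of_nonneg_left h2 h0.le]
    have h5 : ∑ x, (√(μ x) - √(π x)) ^ 2 = ∑ x, (2 * μ x - 2 * (√(μ x) * √(π x))) := by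
      have : ∀ x, (√(μ x) - √(π x)) ^ 2 =
          (2 * μ x - 2 * (√(μ x) * √(π x))) + (π x - μ x) := fun x => by
        have a1 := Real.sq_sqrt (hμ x)
        have b1 := Real.sq_sqrt (hπ x).le
        nlinarith
      simp only [this, Finset.sum_add_distrib, Finset.sum_sub_distrib, hμ1, hπ1]
      ring
    rw [h5]
    exact Finset.sum_le_sum fun x _ => h1 x
  refine Real.le_sqrt_of_sq_le (le_trans ?_ hel)
  have cs := Finset.sum_mul_sq_le_sq_mul_sq Finset.univ (fun x => |√(μ x) - √(π x)|)
    (fun x => √(μ x) + √(π x))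
  have e1 : ∀ x, |√(μ x) - √(π x)| * (√(μ x) + √(π x)) = |μ x - π x| := by
    intro x
    have h := add_nonneg (Real.sqrt_nonneg (μ x)) (Real.sqrt_nonneg (π x))
    have e := abs_mul (√(μ x) - √(π x)) (√(μ x) + √(π x))
    rw [abs_of_nonneg h] at e
    rw [← e]
    congr 1
    have a1 := Real.sq_sqrt (hμ x)
    have b1 := Real.sq_sqrt (hπ x).le
    linear_combination a1 - b1
  have e2 : ∑ x, (√(μ x) + √(π x)) ^ 2 ≤ 4 := by
    calc _ ≤ ∑ x, (2 * μ x + 2 * π x) := by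
          refine Finset.sum_le_sum fun x _ => ?_
          have a1 := Real.sq_sqrt (hμ x)
          have b1 := Real.sq_sqrt (hπ x).le
          nlinarith [sq_nonneg (√(μ x) - √(π x))]
      _ = 4 := by
          rw [Finset.sum_add_distrib, ← Finset.mul_sum, ← Finset.mul_sum, hμ1, hπ1]
          norm_num
  simp only [e1, sq_abs] at cs
  rw [tvDist, mul_pow]
  nlinarith [Finset.sum_nonneg (s := Finset.univ) fun x _ => sq_nonneg (√(μ x) - √(π x))]

/-- Tangent-line inequality for `w log w`. -/
lemma tangent_mul_log {w m : ℝ} (hw : 0 ≤ w) (hm : 0 < m) :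
    w * Real.log m + w - m ≤ w * Real.log w := by
  rcases hw.eq_or_lt with rfl | hw
  · simp [hm.le]
  have h := mul_log_le hw hm
  have h2 := Real.log_le_sub_one_of_pos (div_pos hm hw)
  rw [Real.log_div hm.ne' hw.ne'] at h2
  have h3 : w * (m / w - 1) = m - w := by field_simp
  nlinarith [mul_le_mul_of_nonneg_left h2 hw.le]

/-- Log-sum inequality for a mixture `∑ r_a w_a` of densities bounded by `c * exp (e_a)`. -/
lemma mixture_mul_log_le {A : Type*} [Fintype A] {r w e : A → ℝ} {c q : ℝ} (hr : ∀ a, 0 ≤ r a)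
    (hw : ∀ a, 0 ≤ w a) (hc : 0 < c) (hq : 0 < q) (he : ∀ a, 0 ≤ e a)
    (hwe : ∀ a, w a ≤ c * Real.exp (e a)) :
    (∑ a, r a * w a) * Real.log ((∑ a, r a * w a) / (q * c)) ≤
      (∑ a, r a * w a) * Real.log ((∑ a, r a) / q) + ∑ a, r a * w a * e a := by
  set P := ∑ a, r a * w a with hP
  set p := ∑ a, r a with hp
  have hP0 : 0 ≤ P := Finset.sum_nonneg fun a _ => mul_nonneg (hr a) (hw a)
  rcases hP0.eq_or_lt with h0 | h0
  · rw [← h0]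
    simp only [zero_mul, zero_add]
    exact Finset.sum_nonneg fun a _ => mul_nonneg (mul_nonneg (hr a) (hw a)) (he a)
  have hp0 : 0 < p := by
    refine lt_of_le_of_ne (Finset.sum_nonneg fun a _ => hr a) fun h => h0.ne' ?_
    have := (Finset.sum_eq_zero_iff_of_nonneg fun a _ => hr a).1 h.symm
    exact Finset.sum_eq_zero fun a ha => by rw [this a ha, zero_mul]
  have h1 : P * Real.log (P / p) ≤ ∑ a, r a * (w a * Real.log (w a)) := by
    have h2 := Finset.sum_le_sum fun a (_ : a ∈ Finset.univ) =>
      mul_le_mul_of_nonneg_left (tangent_mul_log (hw a) (div_pos h0 hp0)) (hr a)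
    refine le_trans (le_of_eq ?_) h2
    simp only [mul_sub, mul_add, Finset.sum_sub_distrib, Finset.sum_add_distrib, ← Finset.sum_mul,
      ← mul_assoc, ← hP, ← hp]
    rw [mul_div_cancel₀ _ hp0.ne']
    ring
  have h3 : ∑ a, r a * (w a * Real.log (w a)) ≤ ∑ a, (r a * w a * Real.log c + r a * w a * e a) := by
    refine Finset.sum_le_sum fun a _ => ?_
    rw [mul_assoc, mul_assoc, ← mul_add, ← mul_add]
    refine mul_le_mul_of_nonneg_left ?_ (hr a)
    rcases (hw a).eq_or_lt with h4 | h4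
    · simp [← h4]
    · refine mul_le_mul_of_nonneg_left ?_ h4.le
      have := Real.log_le_log h4 (hwe a)
      rwa [Real.log_mul hc.ne' (Real.exp_pos _).ne', Real.log_exp] at this
  rw [Finset.sum_add_distrib, ← Finset.sum_mul, ← hP] at h3
  rw [Real.log_div h0.ne' hp0.ne'] at h1
  rw [Real.log_div h0.ne' (by positivity), Real.log_mul hq.ne' hc.ne',
    Real.log_div hp0.ne' hq.ne']
  linarith

end Entropy

end MarkovChain

namespace Lamplighter

open MarkovChain

variable {V : Type*} [Fintype V] [DecidableEq V]

/-! ### The chain recording the lamps not yet refreshed -/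

section Refresh

variable (G : SimpleGraph V) [DecidableRel G.Adj]

/-- The generator on pairs (position, set of lamps that have not been refreshed yet). Flipping the
lamp at rate `1/2` is the same as refreshing it, by a fresh fair coin, at rate `1`. -/
noncomputable def refreshGen : Matrix (V × Finset V) (V × Finset V) ℝ :=
  toMatrix fun f x => (f (x.1, x.2.erase x.1) - f (x.1, x.2)) +
    (1 / (2 * (G.degree x.1 : ℝ))) * ∑ j ∈ G.neighborFinset x.1, (f (j, x.2) - f (x.1, x.2))

lemma refreshGen_sum (f : V × Finset V → ℝ) (x : V × Finset V) : ∑ y, refreshGen G x y * f y =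
    (f (x.1, x.2.erase x.1) - f (x.1, x.2)) +
    (1 / (2 * (G.degree x.1 : ℝ))) * ∑ j ∈ G.neighborFinset x.1, (f (j, x.2) - f (x.1, x.2)) := by
  unfold refreshGen
  rw [sum_toMatrix_mul]
  constructor
  · intro f g
    ext x
    have : ∑ j ∈ G.neighborFinset x.1, ((f + g) (j, x.2) - (f + g) (x.1, x.2)) =
        ∑ j ∈ G.neighborFinset x.1, (f (j, x.2) - f (x.1, x.2)) +
        ∑ j ∈ G.neighborFinset x.1, (g (j, x.2) - g (x.1, x.2)) := by
      rw [← Finset.sum_add_distrib]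
      exact Finset.sum_congr rfl fun _ _ => by simp only [Pi.add_apply]; ring
    rw [this]
    simp only [Pi.add_apply]
    ring
  · intro c f
    ext x
    have : ∑ j ∈ G.neighborFinset x.1, ((c • f) (j, x.2) - (c • f) (x.1, x.2)) =
        c * ∑ j ∈ G.neighborFinset x.1, (f (j, x.2) - f (x.1, x.2)) := by
      rw [Finset.mul_sum]
      exact Finset.sum_congr rfl fun _ _ => by simp only [Pi.smul_apply, smul_eq_mul]; ring
    rw [this]
    simp only [Pi.smul_apply, smul_eq_mul]
    ring

lemma refreshGen_nonneg {x y : V × Finset V} (h : x ≠ y) : 0 ≤ refreshGen G x y := by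
  have h1 := refreshGen_sum G (Pi.single y 1) x
  simp only [Pi.single_apply, mul_ite, mul_one, mul_zero, Finset.sum_ite_eq', Finset.mem_univ,
    if_true, Prod.mk.eta, if_neg h, sub_zero] at h1
  rw [h1]
  have h2 : 0 ≤ ∑ j ∈ G.neighborFinset x.1, (if (j, x.2) = y then (1 : ℝ) else 0) :=
    Finset.sum_nonneg fun j _ => by split_ifs <;> norm_num
  have h3 : (0 : ℝ) ≤ if (x.1, x.2.erase x.1) = y then 1 else 0 := by split_ifs <;> norm_num
  positivity

/-- The law of the lamps given that exactly those in `U` still have their initial value `σ₀`. -/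
noncomputable def lampDensity (σ₀ : V → Bool) (U : Finset V) (σ : V → Bool) : ℝ :=
  ∏ x, if x ∈ U then (if σ x = σ₀ x then 1 else 0) else 1 / 2

lemma lampDensity_nonneg (σ₀ : V → Bool) (U : Finset V) (σ : V → Bool) :
    0 ≤ lampDensity σ₀ U σ :=
  Finset.prod_nonneg fun x _ => by split_ifs <;> norm_num

lemma lampDensity_le (σ₀ : V → Bool) (U : Finset V) (σ : V → Bool) :
    lampDensity σ₀ U σ ≤ (1 / 2) ^ Fintype.card V * Real.exp U.card := by
  have h1 : (1 / 2 : ℝ) ^ Fintype.card V * Real.exp U.card =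
      ∏ x : V, (1 / 2 : ℝ) * (if x ∈ U then Real.exp 1 else 1) := by
    rw [Finset.prod_mul_distrib, Finset.prod_ite_mem, Finset.univ_inter, Finset.prod_const,
      Finset.prod_const, Finset.card_univ, ← Real.exp_nat_mul, mul_one]
  rw [h1]
  refine Finset.prod_le_prod (fun x _ => by split_ifs <;> norm_num) fun x _ => ?_
  have := Real.exp_one_gt_d9
  split_ifs <;> linarith

lemma sum_lampDensity (σ₀ : V → Bool) (U : Finset V) : ∑ σ, lampDensity σ₀ U σ = 1 := by
  have h := Finset.prod_univ_sum (fun _ : V => (Finset.univ : Finset Bool))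
    (fun x b => if x ∈ U then (if b = σ₀ x then 1 else 0) else (1 / 2 : ℝ))
  rw [Fintype.piFinset_univ] at h
  unfold lampDensity
  rw [← h]
  refine Finset.prod_eq_one fun x _ => ?_
  by_cases hx : x ∈ U
  · simp [hx]
  · simp [hx]

lemma lampDensity_univ (σ₀ σ : V → Bool) :
    lampDensity σ₀ Finset.univ σ = if σ = σ₀ then 1 else 0 := by
  unfold lampDensity
  simp only [Finset.mem_univ, if_true]
  by_cases h : σ = σ₀
  · simp [h]
  · obtain ⟨x, hx⟩ := Function.ne_iff.1 h
    rw [if_neg h]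
    exact Finset.prod_eq_zero (Finset.mem_univ x) (if_neg hx)

/-- Refreshing a lamp averages over its two states. -/
lemma lampDensity_erase (σ₀ : V → Bool) (U : Finset V) (σ : V → Bool) (i : V) :
    lampDensity σ₀ (U.erase i) σ =
      1 / 2 * (lampDensity σ₀ U σ + lampDensity σ₀ U (flip σ i)) := by
  unfold lampDensity
  rw [← Finset.mul_prod_erase _ _ (Finset.mem_univ i),
    ← Finset.mul_prod_erase _ (fun x => if x ∈ U then (if σ x = σ₀ x then (1 : ℝ) else 0)
      else 1 / 2) (Finset.mem_univ i),
    ← Finset.mul_prod_erase _ (fun x => if x ∈ U then (if flip σ i x = σ₀ x then (1 : ℝ) else 0)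
      else 1 / 2) (Finset.mem_univ i)]
  have e1 : ∏ x ∈ Finset.univ.erase i, (if x ∈ U.erase i then (if σ x = σ₀ x then (1 : ℝ) else 0)
      else 1 / 2) = ∏ x ∈ Finset.univ.erase i, (if x ∈ U then (if σ x = σ₀ x then (1 : ℝ) else 0)
      else 1 / 2) :=
    Finset.prod_congr rfl fun x hx => by simp [Finset.mem_erase, Finset.ne_of_mem_erase hx]
  have e2 : ∏ x ∈ Finset.univ.erase i, (if x ∈ U then (if flip σ i x = σ₀ x then (1 : ℝ) else 0)
      else 1 / 2) = ∏ x ∈ Finset.univ.erase i, (if x ∈ U then (if σ x = σ₀ x then (1 : ℝ) else 0)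
      else 1 / 2) :=
    Finset.prod_congr rfl fun x hx => by rw [flip_of_ne σ (Finset.ne_of_mem_erase hx)]
  rw [e1, e2, ← add_mul, ← mul_assoc, flip_self]
  congr 1
  simp only [Finset.mem_erase, ne_eq, not_true_eq_false, false_and, if_false]
  by_cases hi : i ∈ U
  · rw [if_pos hi, if_pos hi]
    cases σ i <;> cases σ₀ i <;> norm_num
  · rw [if_neg hi, if_neg hi]
    norm_num

/-- The kernel from (position, unrefreshed lamps) to (position, lamps). -/
noncomputable def lampKernel (σ₀ : V → Bool) : Matrix (V × Finset V) (V × (V → Bool)) ℝ :=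
  Matrix.of fun x y => if x.1 = y.1 then lampDensity σ₀ x.2 y.2 else 0

lemma lampKernel_mulVec (σ₀ : V → Bool) (f : V × (V → Bool) → ℝ) (x : V × Finset V) :
    (lampKernel σ₀ *ᵥ f) x = ∑ σ, lampDensity σ₀ x.2 σ * f (x.1, σ) := by
  simp [lampKernel, Matrix.mulVec, dotProduct, Fintype.sum_prod_type, ite_mul,
    Finset.sum_ite_irrel]

lemma mul_eq_of_mulVec {m n : Type*} [Fintype m] [Fintype n] [DecidableEq n] {A : Matrix m m ℝ}
    {B : Matrix n n ℝ} {Λ : Matrix m n ℝ}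
    (h : ∀ (f : n → ℝ) x, ∑ y, A x y * (Λ *ᵥ f) y = (Λ *ᵥ fun z => ∑ y, B z y * f y) x) :
    A * Λ = Λ * B := by
  refine Matrix.ext_of_mulVec_single fun j => ?_
  rw [← Matrix.mulVec_mulVec, ← Matrix.mulVec_mulVec]
  ext x
  exact h _ x

lemma refresh_intertwine_lamp (σ₀ : V → Bool) :
    refreshGen G * lampKernel σ₀ = lampKernel σ₀ * lampGen G := by
  refine mul_eq_of_mulVec fun f x => ?_
  obtain ⟨i, U⟩ := x
  rw [refreshGen_sum, lampKernel_mulVec]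
  simp only [lampKernel_mulVec, lampGen_sum]
  have e1 : ∑ σ, lampDensity σ₀ U (flip σ i) * f (i, σ) =
      ∑ σ, lampDensity σ₀ U σ * f (i, flip σ i) := by
    let e : (V → Bool) ≃ (V → Bool) := Function.Involutive.toPerm (fun σ => flip σ i)
      (fun σ => flip_flip σ i)
    have := Equiv.sum_comp e (fun σ => lampDensity σ₀ U σ * f (i, flip σ i))
    rw [← this]
    refine Finset.sum_congr rfl fun σ _ => ?_
    change _ = lampDensity σ₀ U (flip σ i) * f (i, flip (flip σ i) i)
    rw [flip_flip]
  have e2 : ∑ σ, lampDensity σ₀ (U.erase i) σ * f (i, σ) =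
      1 / 2 * (∑ σ, lampDensity σ₀ U σ * f (i, σ) +
        ∑ σ, lampDensity σ₀ U σ * f (i, flip σ i)) := by
    rw [← e1, ← Finset.sum_add_distrib, Finset.mul_sum]
    exact Finset.sum_congr rfl fun σ _ => by rw [lampDensity_erase]; ring
  have e3 : ∑ j ∈ G.neighborFinset i, (∑ σ, lampDensity σ₀ U σ * f (j, σ) -
      ∑ σ, lampDensity σ₀ U σ * f (i, σ)) =
      ∑ σ, lampDensity σ₀ U σ * ∑ j ∈ G.neighborFinset i, (f (j, σ) - f (i, σ)) := by
    simp only [Finset.mul_sum, ← Finset.sum_sub_distrib, ← mul_sub]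
    rw [Finset.sum_comm]
  rw [e2, e3]
  simp only [mul_add, mul_sub, Finset.sum_add_distrib, Finset.sum_sub_distrib, Finset.mul_sum]
  have e4 : ∀ c : ℝ, ∑ σ, lampDensity σ₀ U σ * (c * f (i, flip σ i)) =
      c * ∑ σ, lampDensity σ₀ U σ * f (i, flip σ i) := fun c => by
    rw [Finset.mul_sum]
    exact Finset.sum_congr rfl fun _ _ => by ring
  have e5 : ∀ c : ℝ, ∑ σ, lampDensity σ₀ U σ * (c * f (i, σ)) =
      c * ∑ σ, lampDensity σ₀ U σ * f (i, σ) := fun c => by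
    rw [Finset.mul_sum]
    exact Finset.sum_congr rfl fun _ _ => by ring
  simp only [e4, e5, ← Finset.mul_sum]
  have e6 : ∑ σ, lampDensity σ₀ U σ * (1 / (2 * (G.degree i : ℝ)) *
      ∑ j ∈ G.neighborFinset i, f (j, σ)) = 1 / (2 * (G.degree i : ℝ)) *
      ∑ σ, lampDensity σ₀ U σ * ∑ j ∈ G.neighborFinset i, f (j, σ) := by
    rw [Finset.mul_sum]
    exact Finset.sum_congr rfl fun _ _ => by ring
  have e7 : ∑ σ, lampDensity σ₀ U σ * (1 / (2 * (G.degree i : ℝ)) *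
      ∑ _j ∈ G.neighborFinset i, f (i, σ)) = 1 / (2 * (G.degree i : ℝ)) *
      ∑ σ, lampDensity σ₀ U σ * ∑ _j ∈ G.neighborFinset i, f (i, σ) := by
    rw [Finset.mul_sum]
    exact Finset.sum_congr rfl fun _ _ => by ring
  rw [e6, e7]
  ring

/-- The projection onto the position. -/
noncomputable def posKernel (V : Type*) [DecidableEq V] : Matrix (V × Finset V) V ℝ :=
  Matrix.of fun x j => if x.1 = j then 1 else 0

lemma refresh_intertwine_pos :
    refreshGen G * posKernel V = posKernel V * ((1 / 2 : ℝ) • walkGen G) := by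
  have hk : ∀ (f : V → ℝ) x, (posKernel V *ᵥ f) x = f x.1 := fun f x => by
    simp [posKernel, Matrix.mulVec, dotProduct]
  refine mul_eq_of_mulVec fun f x => ?_
  rw [refreshGen_sum]
  simp only [hk, Matrix.smul_apply, smul_eq_mul, mul_assoc, ← Finset.mul_sum, walkGen_sum]
  rw [sub_self, zero_add, one_div, mul_inv]
  ring

/-- The generator of the walk at rate `1/2`, killed at rate `1` at `x`. -/
noncomputable def killedGen (x : V) : Matrix V V ℝ :=
  (1 / 2 : ℝ) • walkGen G - Matrix.diagonal (Pi.single x 1)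

lemma killedGen_sum (x : V) (f : V → ℝ) (i : V) : ∑ j, killedGen G x i j * f j =
    1 / 2 * ∑ j, walkGen G i j * f j - (if i = x then f i else 0) := by
  simp only [killedGen, Matrix.sub_apply, Matrix.smul_apply, smul_eq_mul, sub_mul,
    Finset.sum_sub_distrib, mul_assoc, Matrix.diagonal_apply, Pi.single_apply, ite_mul, one_mul,
    zero_mul, Finset.sum_ite_eq, Finset.mem_univ, if_true, Finset.mul_sum]

/-- The kernel picking out the event that the lamp at `x` has not been refreshed. -/
noncomputable def aliveKernel (x : V) : Matrix (V × Finset V) V ℝ :=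
  Matrix.of fun y j => if y.1 = j then (if x ∈ y.2 then 1 else 0) else 0

lemma aliveKernel_mulVec (x : V) (f : V → ℝ) (y : V × Finset V) :
    (aliveKernel x *ᵥ f) y = if x ∈ y.2 then f y.1 else 0 := by
  simp [aliveKernel, Matrix.mulVec, dotProduct]

lemma refresh_intertwine_alive (x : V) :
    refreshGen G * aliveKernel x = aliveKernel x * killedGen G x := by
  refine mul_eq_of_mulVec fun f y => ?_
  obtain ⟨i, U⟩ := y
  rw [refreshGen_sum]
  simp only [aliveKernel_mulVec, killedGen_sum, walkGen_sum]
  by_cases hx : x ∈ U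
  · by_cases hi : i = x
    · subst hi
      simp only [hx, if_true, Finset.notMem_erase, if_false, one_div, mul_inv]
      ring
    · simp only [hx, if_true, Finset.mem_erase, Ne.symm hi, hi, ne_eq, not_false_eq_true, and_true,
        if_false, one_div, mul_inv]
      ring
  · simp [hx]

end Refresh

/-! ### Mixing of the lamplighter chain -/

section Mixing

variable {G : SimpleGraph V} [DecidableRel G.Adj] [Nontrivial V]

/-- Pointwise exponential decay along a dissipative semigroup. -/
lemma abs_transition_mulVec_le (hG : G.Connected) {A : Matrix V V ℝ} {l K : ℝ} {u : V → ℝ}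
    (h : ∀ t, l * expect (walkLaw G) (fun x => (transition A t *ᵥ u) x ^ 2) ≤
      -expect (walkLaw G) (fun x => (transition A t *ᵥ u) x * (A *ᵥ (transition A t *ᵥ u)) x))
    (hK : expect (walkLaw G) (fun x => u x ^ 2) ≤ K)
    {S : ℝ} (hS : ∑ j, (G.degree j : ℝ) ≤ S) (hKS : K ≤ S)
    {t : ℝ} (ht : 0 ≤ t) (x : V) :
    |(transition A t *ᵥ u) x| ≤ S * Real.exp (-(l * t)) := by
  have h1 := expect_transition_sq_le h ht
  have hS0 : 0 < S := (sum_degree_pos hG).trans_le hS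
  have h2 : walkLaw G x * (transition A t *ᵥ u) x ^ 2 ≤
      expect (walkLaw G) (fun x => (transition A t *ᵥ u) x ^ 2) :=
    Finset.single_le_sum (f := fun x => walkLaw G x * (transition A t *ᵥ u) x ^ 2)
      (fun y _ => mul_nonneg (walkLaw_pos hG y).le (sq_nonneg _)) (Finset.mem_univ x)
  have h3 : 1 / S ≤ walkLaw G x :=
    (one_div_le_one_div_of_le (sum_degree_pos hG) hS).trans (one_div_sum_degree_le_walkLaw hG x)
  have h4 : 1 / S * (transition A t *ᵥ u) x ^ 2 ≤ Real.exp (-(2 * l * t)) * S :=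
    (mul_le_mul_of_nonneg_right h3 (sq_nonneg _)).trans
      (h2.trans (h1.trans (mul_le_mul_of_nonneg_left (hK.trans hKS) (Real.exp_pos _).le)))
  refine abs_le_of_sq_le_sq ?_ (by positivity)
  rw [one_div_mul_eq_div, div_le_iff₀ hS0] at h4
  refine h4.trans (le_of_eq ?_)
  rw [mul_pow, ← Real.exp_nat_mul]
  push_cast
  rw [show 2 * -(l * t) = -(2 * l * t) by ring]
  ring

/-- Relative-entropy mixing of the lamplighter, when oscillations of functions on the graph are
controlled by their Dirichlet form with constant `R`. By convexity, the relative entropy is at most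
that of the position plus the expected number of unrefreshed lamps; both decay at a rate of order
`1 / R`. -/
lemma relEntropy_transition_le (hG : G.Connected) {R : ℝ}
    (hSR : ∑ j, (G.degree j : ℝ) ≤ R)
    (hR : ∀ (v : V → ℝ) x y, (v y - v x) ^ 2 ≤ R * dirichletForm (walkGen G) (walkLaw G) v v)
    {t : ℝ} (ht : 0 ≤ t) (x₀ : V × (V → Bool)) :
    relEntropy (transition (lampGen G) t x₀) (lampLaw G) ≤
      ((Fintype.card V : ℝ) + 1) * (R * Real.exp (-(1 / (4 * R) * t))) := by
  obtain ⟨i₀, σ₀⟩ := x₀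
  have Hw := walk_isIrreducibleReversible hG
  have hπ := Hw.prob_nonneg
  have hS := sum_degree_pos hG
  have hR0 : 0 < R := hS.trans_le hSR
  have hR1 : 1 ≤ R := by
    have h1 := Finset.single_le_sum (f := fun j => (G.degree j : ℝ))
      (fun j _ => (degree_pos hG j).le) (Finset.mem_univ i₀)
    have h2 : (1 : ℝ) ≤ G.degree i₀ := by
      exact_mod_cast hG.preconnected.degree_pos_of_nontrivial i₀
    linarith
  set δ := R * Real.exp (-(1 / (4 * R) * t)) with hδ
  have hδ0 : 0 < δ := by positivity
  set r : V → Finset V → ℝ := fun j U => transition (refreshGen G) t (i₀, Finset.univ) (j, U) with hr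
  have hr0 : ∀ j U, 0 ≤ r j U := fun j U =>
    transition_nonneg (fun x y h => refreshGen_nonneg G h) ht _ _
  -- the three projections of the auxiliary chain
  have law : ∀ j τ, transition (lampGen G) t (i₀, σ₀) (j, τ) =
      ∑ U, r j U * lampDensity σ₀ U τ := by
    intro j τ
    have h := congrFun (congrFun (transition_mul_of_intertwine (refresh_intertwine_lamp G σ₀) t)
      (i₀, Finset.univ)) (j, τ)
    rw [Matrix.mul_apply, Matrix.mul_apply, Fintype.sum_prod_type, Fintype.sum_prod_type] at h
    simpa [lampKernel, lampDensity_univ, ite_and, Finset.sum_ite_irrel] using h.symm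
  have pos : ∀ j, ∑ U, r j U = transition ((1 / 2 : ℝ) • walkGen G) t i₀ j := by
    intro j
    have h := congrFun (congrFun (transition_mul_of_intertwine (refresh_intertwine_pos G) t)
      (i₀, Finset.univ)) j
    rw [Matrix.mul_apply, Matrix.mul_apply, Fintype.sum_prod_type] at h
    simpa [posKernel, Finset.sum_ite_irrel] using h
  have alive : ∀ x, ∑ j, ∑ U, r j U * (if x ∈ U then 1 else 0) =
      (transition (killedGen G x) t *ᵥ fun _ => 1) i₀ := by
    intro x
    have h := congrFun (congrArg (fun M => M *ᵥ fun _ => (1 : ℝ))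
      (transition_mul_of_intertwine (refresh_intertwine_alive G x) t)) (i₀, Finset.univ)
    simp only [← Matrix.mulVec_mulVec] at h
    rw [aliveKernel_mulVec, Matrix.mulVec, dotProduct, Fintype.sum_prod_type] at h
    simpa [aliveKernel_mulVec] using h
  -- decay of the position
  have hpos : ∀ j, |(∑ U, r j U) / walkLaw G j - 1| ≤ δ := by
    intro j
    have hj := walkLaw_pos hG j
    set u : V → ℝ := fun i => (if i = j then 1 / walkLaw G j else 0) - 1 with hu
    have hmean : expect (walkLaw G) u = 0 := by
      rw [hu, expect_sub, expect_const Hw.prob_sum]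
      simp [expect, hj.ne']
    have e : (transition ((1 / 2 : ℝ) • walkGen G) t *ᵥ u) i₀ =
        (∑ U, r j U) / walkLaw G j - 1 := by
      rw [pos]
      have h1 := transition_row_sum (A := (1 / 2 : ℝ) • walkGen G)
        (fun x => by simp [← Finset.mul_sum, Hw.row_sum]) t i₀
      simp only [one_div] at h1
      simp [Matrix.mulVec, dotProduct, hu, mul_sub, Finset.sum_sub_distrib, h1, div_eq_mul_inv]
    rw [← e]
    refine abs_transition_mulVec_le hG (l := 1 / (4 * R)) (K := R) (fun s => ?_) ?_ hSR le_rfl ht i₀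
    · set v := transition ((1 / 2 : ℝ) • walkGen G) s *ᵥ u with hv
      have hvm : expect (walkLaw G) v = 0 := by
        have h1 := transition_mul_of_intertwine (A := (0 : Matrix Unit Unit ℝ))
          (B := (1 / 2 : ℝ) • walkGen G) (Λ := Matrix.of fun _ x => walkLaw G x) (by
            ext a y
            have e0 : ∑ x, walkLaw G x * walkGen G x y = 0 := by
              rw [Finset.sum_congr rfl fun x _ => Hw.reversible x y, ← Finset.mul_sum,
                Hw.row_sum, mul_zero]
            simp only [Matrix.mul_apply, Matrix.zero_apply, zero_mul, Finset.sum_const_zero,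
              Matrix.of_apply, Matrix.smul_apply, smul_eq_mul]
            calc (0 : ℝ) = 1 / 2 * ∑ x, walkLaw G x * walkGen G x y := by rw [e0, mul_zero]
              _ = _ := by
                rw [Finset.mul_sum]
                exact Finset.sum_congr rfl fun x _ => by ring) s
        have h2 := congrFun (congrArg (fun M => M *ᵥ u) h1) ()
        simp only [transition_zero_gen, Matrix.one_mul, ← Matrix.mulVec_mulVec, ← hv] at h2
        rw [← hmean]
        simpa [expect, Matrix.mulVec, dotProduct] using h2.symm
      have h1 : expect (walkLaw G) (fun x => v x ^ 2) ≤
          R * dirichletForm (walkGen G) (walkLaw G) v v := by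
        have h2 : expect (walkLaw G) (fun x => (v x - v i₀) ^ 2) ≤
            R * dirichletForm (walkGen G) (walkLaw G) v v := by
          rw [← expect_const Hw.prob_sum (R * _)]
          exact expect_mono hπ fun x => hR v i₀ x
        rw [expect_sub_sq Hw.prob_sum, hvm] at h2
        nlinarith [sq_nonneg (v i₀)]
      have h3 : -expect (walkLaw G) (fun x => v x * (((1 / 2 : ℝ) • walkGen G) *ᵥ v) x) =
          1 / 2 * dirichletForm (walkGen G) (walkLaw G) v v := by
        rw [Hw.dirichletForm_eq, mul_neg, ← expect_smul]
        congr 2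
        ext x
        rw [Matrix.smul_mulVec]
        simp only [Pi.smul_apply, Matrix.mulVec, dotProduct, smul_eq_mul]
        ring
      rw [h3, div_mul_eq_mul_div, div_le_iff₀ (by positivity)]
      have h4 := dirichletForm_self_nonneg Hw.rate_nonneg hπ v
      nlinarith [mul_nonneg hR0.le h4]
    · have h1 : expect (walkLaw G) (fun i => if i = j then 1 / walkLaw G j else 0) = 1 := by
        simp [expect, hj.ne']
      have h2 : expect (walkLaw G) (fun i => (if i = j then 1 / walkLaw G j else 0) ^ 2) =
          1 / walkLaw G j := by
        simp only [expect, ite_pow, mul_ite, ne_eq, OfNat.ofNat_ne_zero, not_false_eq_true,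
          zero_pow, mul_zero, Finset.sum_ite_eq', Finset.mem_univ, if_true]
        field_simp
      have h3 := one_div_sum_degree_le_walkLaw hG j
      have h4 : 1 / walkLaw G j ≤ R := by
        rw [div_le_iff₀ hj]
        rw [div_le_iff₀ hS] at h3
        nlinarith
      rw [hu, expect_sub_sq Hw.prob_sum, h1, h2]
      linarith
  -- decay of the probability that a lamp is not refreshed
  have halive : ∀ x, ∑ j, ∑ U, r j U * (if x ∈ U then 1 else 0) ≤ δ := by
    intro x
    rw [alive]
    refine (le_abs_self _).trans (abs_transition_mulVec_le hG (l := 1 / (4 * R)) (K := 1)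
      (fun s => ?_) ?_ hSR hR1 ht i₀)
    · set v := transition (killedGen G x) s *ᵥ fun _ => (1 : ℝ) with hv
      have h3 : -expect (walkLaw G) (fun y => v y * (killedGen G x *ᵥ v) y) =
          1 / 2 * dirichletForm (walkGen G) (walkLaw G) v v + walkLaw G x * v x ^ 2 := by
        have e1 : ∀ y, v y * (killedGen G x *ᵥ v) y =
            1 / 2 * (v y * ∑ j, walkGen G y j * v j) - (if y = x then v y ^ 2 else 0) := by
          intro y
          have := killedGen_sum G x v y
          rw [Matrix.mulVec, dotProduct, this]
          split_ifs <;> ring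
        have e2 : expect (walkLaw G) (fun y => if y = x then v y ^ 2 else 0) =
            walkLaw G x * v x ^ 2 := by simp [expect]
        simp only [e1]
        rw [expect_sub, expect_smul, e2, Hw.dirichletForm_eq]
        ring
      have h1 : expect (walkLaw G) (fun y => v y ^ 2) ≤
          2 * (R * dirichletForm (walkGen G) (walkLaw G) v v) + 2 * v x ^ 2 := by
        rw [← expect_const Hw.prob_sum (2 * (R * _) + _)]
        refine expect_mono hπ fun y => ?_
        have := hR v x y
        nlinarith [sq_nonneg (v y - 2 * v x)]
      have h2 : v x ^ 2 ≤ R * (walkLaw G x * v x ^ 2) := by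
        have h4 := one_div_sum_degree_le_walkLaw hG x
        rw [div_le_iff₀ hS] at h4
        have h5 : 1 ≤ R * walkLaw G x := by nlinarith [walkLaw_pos hG x]
        nlinarith [sq_nonneg (v x)]
      have h4 : 0 ≤ R * (walkLaw G x * v x ^ 2) := (sq_nonneg _).trans h2
      rw [h3, div_mul_eq_mul_div, div_le_iff₀ (by positivity)]
      nlinarith
    · simp [expect_const Hw.prob_sum]
  -- convexity of the relative entropy
  have hc : (0 : ℝ) < (1 / 2) ^ Fintype.card V := by positivity
  have step : relEntropy (transition (lampGen G) t (i₀, σ₀)) (lampLaw G) ≤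
      ∑ j, ∑ τ, ((∑ U, r j U * lampDensity σ₀ U τ) * δ +
        ∑ U, r j U * lampDensity σ₀ U τ * U.card) := by
    rw [relEntropy, Fintype.sum_prod_type]
    refine Finset.sum_le_sum fun j _ => Finset.sum_le_sum fun τ _ => ?_
    rw [law]
    have h1 := mixture_mul_log_le (r := r j) (w := fun U => lampDensity σ₀ U τ)
      (e := fun U => (U.card : ℝ)) (hr0 j) (fun U => lampDensity_nonneg _ _ _) hc (walkLaw_pos hG j)
      (fun U => Nat.cast_nonneg _) (fun U => lampDensity_le _ _ _)
    refine h1.trans (add_le_add_left (mul_le_mul_of_nonneg_left ?_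
      (Finset.sum_nonneg fun U _ => mul_nonneg (hr0 j U) (lampDensity_nonneg _ _ _))) _)
    have h2 := (abs_le.1 (hpos j)).2
    rcases (div_nonneg (Finset.sum_nonneg fun U (_ : U ∈ Finset.univ) => hr0 j U)
      (walkLaw_pos hG j).le).eq_or_lt with h3 | h3
    · rw [← h3, Real.log_zero]
      exact hδ0.le
    · exact (Real.log_le_sub_one_of_pos h3).trans h2
  refine step.trans (le_of_eq_of_le (b := δ + ∑ x, ∑ j, ∑ U, r j U * (if x ∈ U then 1 else 0)) ?_ ?_)
  · simp only [Finset.sum_add_distrib, ← Finset.sum_mul]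
    congr 1
    · have h1 : ∑ j, ∑ τ, ∑ U, r j U * lampDensity σ₀ U τ = 1 := by
        have h2 := transition_row_sum (A := lampGen G)
          (lamp_isIrreducibleReversible hG).row_sum t (i₀, σ₀)
        rw [Fintype.sum_prod_type] at h2
        simpa only [law] using h2
      rw [h1, one_mul]
    · have h1 : ∀ j, ∑ τ, ∑ U, r j U * lampDensity σ₀ U τ * (U.card : ℝ) =
          ∑ U, r j U * (U.card : ℝ) := by
        intro j
        rw [Finset.sum_comm]
        refine Finset.sum_congr rfl fun U _ => ?_
        rw [← Finset.sum_mul, ← Finset.mul_sum, sum_lampDensity, mul_one]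
      simp only [h1]
      symm
      rw [Finset.sum_comm]
      refine Finset.sum_congr rfl fun j _ => ?_
      rw [Finset.sum_comm]
      refine Finset.sum_congr rfl fun U _ => ?_
      rw [← Finset.mul_sum]
      simp
  · have := Finset.sum_le_sum fun x (_ : x ∈ (Finset.univ : Finset V)) => halive x
    rw [Finset.sum_const, Finset.card_univ, nsmul_eq_mul] at this
    linarith

end Mixing

end Lamplighter

namespace Lamplighter

open MarkovChain

lemma walk_dirichletForm_self {V : Type*} [Fintype V] [DecidableEq V] [Nontrivial V]
    {G : SimpleGraph V} [DecidableRel G.Adj] (hG : G.Connected) (v : V → ℝ) :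
    dirichletForm (walkGen G) (walkLaw G) v v =
      1 / (2 * ∑ j, (G.degree j : ℝ)) * ∑ x, ∑ y ∈ G.neighborFinset x, (v y - v x) ^ 2 := by
  have hS := (sum_degree_pos hG).ne'
  rw [dirichletForm_self, expect, Finset.mul_sum, Finset.mul_sum]
  refine Finset.sum_congr rfl fun x _ => ?_
  rw [walkGen_sum, sub_self]
  simp only [ne_eq, OfNat.ofNat_ne_zero, not_false_eq_true, zero_pow, sub_zero]
  have := (degree_pos hG x).ne'
  unfold walkLaw
  field_simp

/-! ### Discrete tori -/

section Torus

variable {k n : ℕ}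

lemma torus_adj {x y : Fin k → ZMod n} : (torus k n).Adj x y ↔
    x ≠ y ∧ ∃ i, x = y + Pi.single i 1 ∨ y = x + Pi.single i 1 := by
  rw [torus, SimpleGraph.circulantGraph_adj]
  simp only [Set.mem_range, eq_sub_iff_add_eq, exists_or, ne_eq]
  simp only [eq_comm, add_comm]

lemma torus_adj_add_single (hn : 3 ≤ n) (x : Fin k → ZMod n) (i : Fin k) :
    (torus k n).Adj x (x + Pi.single i 1) := by
  have : Fact (1 < n) := ⟨by omega⟩
  rw [torus_adj]
  refine ⟨fun h => ?_, i, Or.inr rfl⟩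
  have h1 := congrFun h i
  simp at h1

variable [NeZero n]

lemma torus_degree_le (x : Fin k → ZMod n) : (torus k n).degree x ≤ 2 * k := by
  classical
  rw [← SimpleGraph.card_neighborFinset_eq_degree]
  have h : (torus k n).neighborFinset x ⊆
      Finset.univ.image (fun i : Fin k => x - Pi.single i 1) ∪
      Finset.univ.image (fun i : Fin k => x + Pi.single i 1) := by
    intro y hy
    rw [SimpleGraph.mem_neighborFinset, torus_adj] at hy
    obtain ⟨-, i, h | h⟩ := hy
    · exact Finset.mem_union_left _ (Finset.mem_image.2 ⟨i, Finset.mem_univ _, by simp [h]⟩)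
    · exact Finset.mem_union_right _ (Finset.mem_image.2 ⟨i, Finset.mem_univ _, h.symm⟩)
  refine (Finset.card_le_card h).trans ((Finset.card_union_le _ _).trans ?_)
  have h1 := Finset.card_image_le (s := Finset.univ) (f := fun i : Fin k => x - Pi.single i (1 : ZMod n))
  have h2 := Finset.card_image_le (s := Finset.univ) (f := fun i : Fin k => x + Pi.single i (1 : ZMod n))
  rw [Finset.card_univ, Fintype.card_fin] at h1 h2
  omega

lemma torus_degree_add (x a : Fin k → ZMod n) :
    (torus k n).degree (x + a) = (torus k n).degree x := by
  classical
  rw [← SimpleGraph.card_neighborFinset_eq_degree, ← SimpleGraph.card_neighborFinset_eq_degree]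
  symm
  refine Finset.card_bij (fun y _ => y + a) (fun y hy => ?_) (fun _ _ _ _ h => add_right_cancel h)
    (fun y hy => ⟨y - a, ?_, sub_add_cancel y a⟩)
  · rw [SimpleGraph.mem_neighborFinset] at hy ⊢
    exact SimpleGraph.circulantGraph_adj_translate.2 hy
  · rw [SimpleGraph.mem_neighborFinset] at hy ⊢
    rw [← sub_add_cancel y a] at hy
    exact SimpleGraph.circulantGraph_adj_translate.1 hy

lemma torus_walkLaw_add (x a : Fin k → ZMod n) :
    walkLaw (torus k n) (x + a) = walkLaw (torus k n) x := by
  unfold walkLaw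
  rw [torus_degree_add]

/-- Oscillation along a coordinate line, by Cauchy–Schwarz along a path of length less than `n`. -/
lemma line_sub_sq_le {v : (Fin k → ZMod n) → ℝ} {M : ℝ} {i : Fin k}
    (hM : ∑ w, (v (w + Pi.single i 1) - v w) ^ 2 ≤ M) (z : Fin k → ZMod n) (a : ZMod n) :
    (v (z + Pi.single i a) - v z) ^ 2 ≤ n * M := by
  let p : ℕ → Fin k → ZMod n := fun l => z + Pi.single i (l : ZMod n)
  have hp : ∀ l : ℕ, p (l + 1) = p l + Pi.single i 1 := by
    intro l
    simp only [p]
    rw [Nat.cast_succ, Pi.single_add, add_assoc]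
  have tele : v (z + Pi.single i a) - v z =
      ∑ l ∈ Finset.range a.val, (v (p l + Pi.single i 1) - v (p l)) := by
    simp only [← hp]
    rw [Finset.sum_range_sub (fun l : ℕ => v (p l))]
    simp [p]
  have hlt := ZMod.val_lt a
  have inj : ∑ l ∈ Finset.range a.val, (v (p l + Pi.single i 1) - v (p l)) ^ 2 ≤ M := by
    refine le_trans ?_ hM
    refine (Finset.sum_image (s := Finset.range a.val) (g := p)
      (f := fun w => (v (w + Pi.single i 1) - v w) ^ 2) ?_).symm.le.trans ?_
    · intro l hl l' hl' h
      have h1 : (l : ZMod n) = l' := by simpa [p] using congrFun h i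
      have h2 := congrArg ZMod.val h1
      simp only [Finset.coe_range, Set.mem_Iio] at hl hl'
      rwa [ZMod.val_natCast_of_lt (by omega), ZMod.val_natCast_of_lt (by omega)] at h2
    · exact Finset.sum_le_sum_of_subset_of_nonneg (Finset.subset_univ _) fun _ _ _ => sq_nonneg _
  have hM0 : 0 ≤ M := (Finset.sum_nonneg fun _ _ => sq_nonneg _).trans hM
  rw [tele]
  refine sq_sum_le_card_mul_sum_sq.trans ?_
  rw [Finset.card_range]
  have : (a.val : ℝ) ≤ n := by exact_mod_cast hlt.le
  exact mul_le_mul this inj (Finset.sum_nonneg fun _ _ => sq_nonneg _) (Nat.cast_nonneg _)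

/-- Oscillation of a function on the torus, changing one coordinate after the other. -/
lemma torus_sub_sq_le {v : (Fin k → ZMod n) → ℝ} {M : ℝ}
    (hM : ∀ i, ∑ w, (v (w + Pi.single i 1) - v w) ^ 2 ≤ M) (hM0 : 0 ≤ M) (x y : Fin k → ZMod n) :
    (v y - v x) ^ 2 ≤ k ^ 2 * (n * M) := by
  have key : ∀ (T : Finset (Fin k)) (y : Fin k → ZMod n), (∀ i, i ∉ T → y i = x i) →
      |v y - v x| ≤ T.card * √(n * M) := by
    intro T
    induction T using Finset.induction_on with
    | empty =>
      intro y h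
      simp [show y = x from funext fun i => h i (by simp)]
    | insert a T ha ih =>
      intro y h
      have h1 := ih (y + Pi.single a (x a - y a)) (fun i hi => by
        by_cases hia : i = a
        · subst hia
          simp
        · simpa [hia] using h i (by simp [hia, hi]))
      have h2 : |v (y + Pi.single a (x a - y a)) - v y| ≤ √(n * M) := by
        rw [← Real.sqrt_sq_eq_abs]
        exact Real.sqrt_le_sqrt (line_sub_sq_le (hM a) y _)
      rw [Finset.card_insert_of_notMem ha]
      push_cast
      have h3 := abs_sub_le (v y) (v (y + Pi.single a (x a - y a))) (v x)
      rw [abs_sub_comm] at h2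
      linarith
  have h := key Finset.univ y fun i hi => absurd (Finset.mem_univ i) hi
  rw [Finset.card_univ, Fintype.card_fin] at h
  rw [← sq_abs]
  calc _ ≤ (k * √(n * M)) ^ 2 := pow_le_pow_left₀ (abs_nonneg _) h 2
    _ = _ := by rw [mul_pow, Real.sq_sqrt (by positivity)]

lemma torus_connected (hn : 3 ≤ n) : (torus k n).Connected := by
  classical
  refine ⟨fun x y => ?_⟩
  let v : (Fin k → ZMod n) → ℝ := fun y => if (torus k n).Reachable x y then 1 else 0
  have hv : ∀ w i, v (w + Pi.single i 1) = v w := by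
    intro w i
    have h := (torus_adj_add_single hn w i).reachable
    simp only [v]
    congr 1
    exact propext ⟨fun h' => h'.trans h.symm, fun h' => h'.trans h⟩
  have h := torus_sub_sq_le (v := v) (M := 0) (fun i => by simp [hv]) le_rfl x y
  have h1 : v x = 1 := if_pos (SimpleGraph.Reachable.refl x)
  by_contra hxy
  have h2 : v y = 0 := if_neg hxy
  rw [h1, h2] at h
  norm_num at h

lemma torus_nontrivial (hk : 1 ≤ k) (hn : 3 ≤ n) : Nontrivial (Fin k → ZMod n) := by
  have : Fact (1 < n) := ⟨by omega⟩
  have : Nonempty (Fin k) := ⟨⟨0, hk⟩⟩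
  infer_instance

lemma torus_card : Fintype.card (Fin k → ZMod n) = n ^ k := by
  rw [Fintype.card_fun, ZMod.card, Fintype.card_fin]

lemma torus_sum_degree_le : ∑ x, ((torus k n).degree x : ℝ) ≤ 2 * k * n ^ k := by
  calc _ ≤ ∑ _x : Fin k → ZMod n, (2 * k : ℝ) :=
        Finset.sum_le_sum fun x _ => by exact_mod_cast torus_degree_le x
    _ = _ := by
        rw [Finset.sum_const, Finset.card_univ, torus_card]
        simp
        ring

/-- Oscillation bound of order `n ^ (k + 1)`, the number of vertices times the diameter. -/
lemma torus_resistance (hk : 1 ≤ k) (hn : 3 ≤ n) (v : (Fin k → ZMod n) → ℝ)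
    (x y : Fin k → ZMod n) :
    (v y - v x) ^ 2 ≤ 4 * k ^ 3 * n ^ (k + 1) *
      dirichletForm (walkGen (torus k n)) (walkLaw (torus k n)) v v := by
  have := torus_nontrivial hk hn
  have hG := torus_connected (k := k) hn
  have Hw := walk_isIrreducibleReversible hG
  set E := dirichletForm (walkGen (torus k n)) (walkLaw (torus k n)) v v with hE
  have hE0 : 0 ≤ E := dirichletForm_self_nonneg Hw.rate_nonneg Hw.prob_nonneg v
  have hS := sum_degree_pos hG
  have hS2 := torus_sum_degree_le (k := k) (n := n)
  set S := ∑ x, ((torus k n).degree x : ℝ) with hSdef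
  have h1 : ∑ x, ∑ y ∈ (torus k n).neighborFinset x, (v y - v x) ^ 2 = 2 * S * E := by
    rw [hE, walk_dirichletForm_self hG, ← hSdef]
    field_simp
  have h2 : ∀ i, ∑ w, (v (w + Pi.single i 1) - v w) ^ 2 ≤ 2 * S * E := by
    intro i
    rw [← h1]
    refine Finset.sum_le_sum fun w _ => ?_
    exact Finset.single_le_sum (f := fun y => (v y - v w) ^ 2) (fun _ _ => sq_nonneg _)
      ((SimpleGraph.mem_neighborFinset _ _ _).2 (torus_adj_add_single hn w i))
  refine (torus_sub_sq_le h2 (by positivity) x y).trans ?_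
  calc (k : ℝ) ^ 2 * (n * (2 * S * E)) = 2 * k ^ 2 * n * E * S := by ring
    _ ≤ 2 * k ^ 2 * n * E * (2 * k * n ^ k) := mul_le_mul_of_nonneg_left hS2 (by positivity)
    _ = _ := by ring

/-- The spectral gap of the torus is at most of order `n⁻²`: the test functions are the real and
imaginary parts of the lowest character of a coordinate. -/
lemma torus_gap_le (hk : 1 ≤ k) (hn : 3 ≤ n) : gap (torus k n) ≤ 20 / (n : ℝ) ^ 2 := by
  have := torus_nontrivial hk hn
  have hG := torus_connected (k := k) hn
  have Hw := walk_isIrreducibleReversible hG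
  have hn0 : (0 : ℝ) < n := by exact_mod_cast (by omega : 0 < n)
  let i₀ : Fin k := ⟨0, hk⟩
  let χ : (Fin k → ZMod n) → ℂ := fun x => ZMod.stdAddChar (x i₀)
  have hχnorm : ∀ x, ‖χ x‖ = 1 := fun x => Circle.norm_coe _
  have hχ1 : ‖(ZMod.stdAddChar (1 : ZMod n) : ℂ) - 1‖ ≤ 2 * Real.pi / n := by
    have h := ZMod.stdAddChar_coe (N := n) 1
    rw [Int.cast_one] at h
    rw [h, show 2 * (Real.pi : ℂ) * Complex.I * ((1 : ℤ) : ℂ) / (n : ℂ) =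
      Complex.I * ((2 * Real.pi / n : ℝ) : ℂ) by push_cast; ring]
    refine Real.norm_exp_I_mul_ofReal_sub_one_le.trans (le_of_eq ?_)
    rw [Real.norm_of_nonneg (by positivity)]
  have step : ∀ x i, ‖χ (x + Pi.single i 1) - χ x‖ ≤ 2 * Real.pi / n := by
    intro x i
    by_cases hi : i = i₀
    · subst hi
      have : χ (x + Pi.single i₀ 1) - χ x = χ x * (ZMod.stdAddChar (1 : ZMod n) - 1) := by
        simp only [χ, Pi.add_apply, Pi.single_eq_same, AddChar.map_add_eq_mul]
        ring
      rw [this, norm_mul, hχnorm, one_mul]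
      exact hχ1
    · have : χ (x + Pi.single i 1) - χ x = 0 := by
        simp [χ, Ne.symm hi]
      rw [this, norm_zero]
      positivity
  have sq_norm : ∀ z : ℂ, z.re ^ 2 + z.im ^ 2 = ‖z‖ ^ 2 := fun z => by
    rw [← Complex.normSq_eq_norm_sq, Complex.normSq_apply]
    ring
  -- the character has mean zero by translation invariance
  have hmeanC : ∑ x, (walkLaw (torus k n) x : ℂ) * χ x = 0 := by
    set c := ∑ x, (walkLaw (torus k n) x : ℂ) * χ x with hc
    have h1 : c = c * ZMod.stdAddChar (1 : ZMod n) := by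
      rw [hc, Finset.sum_mul]
      refine (Equiv.sum_comp (Equiv.addRight (Pi.single i₀ (1 : ZMod n)))
        (fun x => (walkLaw (torus k n) x : ℂ) * χ x)).symm.trans ?_
      refine Finset.sum_congr rfl fun x _ => ?_
      simp only [Equiv.coe_addRight, torus_walkLaw_add, χ, Pi.add_apply, Pi.single_eq_same,
        AddChar.map_add_eq_mul]
      ring
    have h2 : (ZMod.stdAddChar (1 : ZMod n) : ℂ) ≠ 1 := by
      intro h
      have h3 : (1 : ZMod n) = 0 := ZMod.injective_stdAddChar (by rw [h, AddChar.map_zero_eq_one])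
      have : Fact (1 < n) := ⟨by omega⟩
      exact one_ne_zero h3
    have h4 : c * (ZMod.stdAddChar (1 : ZMod n) - 1) = 0 := by
      rw [mul_sub, ← h1, mul_one, sub_self]
    exact (mul_eq_zero.1 h4).resolve_right (sub_ne_zero.2 h2)
  have hre : expect (walkLaw (torus k n)) (fun x => (χ x).re) = 0 := by
    have := congrArg Complex.re hmeanC
    simpa [expect] using this
  have him : expect (walkLaw (torus k n)) (fun x => (χ x).im) = 0 := by
    have := congrArg Complex.im hmeanC
    simpa [expect] using this
  have p1 := (spectralGap_spec Hw).2.2 _ hre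
  have p2 := (spectralGap_spec Hw).2.2 _ him
  have hone : expect (walkLaw (torus k n)) (fun x => (χ x).re ^ 2) +
      expect (walkLaw (torus k n)) (fun x => (χ x).im ^ 2) = 1 := by
    rw [← expect_add]
    simp only [sq_norm, hχnorm, one_pow]
    exact expect_const Hw.prob_sum 1
  have hS := sum_degree_pos hG
  have hen : dirichletForm (walkGen (torus k n)) (walkLaw (torus k n)) (fun x => (χ x).re)
      (fun x => (χ x).re) + dirichletForm (walkGen (torus k n)) (walkLaw (torus k n))
      (fun x => (χ x).im) (fun x => (χ x).im) ≤ 1 / 2 * (2 * Real.pi / n) ^ 2 := by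
    rw [walk_dirichletForm_self hG, walk_dirichletForm_self hG, ← mul_add,
      ← Finset.sum_add_distrib]
    have h1 : ∀ x, ∑ y ∈ (torus k n).neighborFinset x, ((χ y).re - (χ x).re) ^ 2 +
        ∑ y ∈ (torus k n).neighborFinset x, ((χ y).im - (χ x).im) ^ 2 ≤
        (torus k n).degree x * (2 * Real.pi / n) ^ 2 := by
      intro x
      rw [← Finset.sum_add_distrib, ← SimpleGraph.card_neighborFinset_eq_degree, ← nsmul_eq_mul]
      refine Finset.sum_le_card_nsmul _ _ _ fun y hy => ?_
      rw [SimpleGraph.mem_neighborFinset, torus_adj] at hy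
      rw [← Complex.sub_re, ← Complex.sub_im, sq_norm]
      refine pow_le_pow_left₀ (norm_nonneg _) ?_ 2
      obtain ⟨-, i, h | h⟩ := hy
      · rw [h, norm_sub_rev]
        exact step y i
      · rw [h]
        exact step x i
    calc _ ≤ 1 / (2 * ∑ j, ((torus k n).degree j : ℝ)) *
          ∑ x, ((torus k n).degree x : ℝ) * (2 * Real.pi / n) ^ 2 :=
          mul_le_mul_of_nonneg_left (Finset.sum_le_sum fun x _ => h1 x) (by positivity)
      _ = _ := by
          rw [← Finset.sum_mul]
          field_simp
  have hpi : Real.pi ^ 2 ≤ 10 := by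
    have := Real.pi_lt_d2
    have := Real.pi_pos
    nlinarith
  have hfin : gap (torus k n) ≤ 1 / 2 * (2 * Real.pi / n) ^ 2 := by
    have : gap (torus k n) * (expect (walkLaw (torus k n)) (fun x => (χ x).re ^ 2) +
      expect (walkLaw (torus k n)) (fun x => (χ x).im ^ 2)) ≤ 1 / 2 * (2 * Real.pi / n) ^ 2 := by
      rw [mul_add]
      exact (add_le_add p1 p2).trans hen
    rwa [hone, mul_one] at this
  refine hfin.trans ?_
  rw [div_pow, ← mul_div_assoc]
  exact div_le_div_of_nonneg_right (by nlinarith) (by positivity)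

end Torus

end Lamplighter

namespace Lamplighter

open MarkovChain

/-- At any time when all relative entropies are at most `min ε (ε²)`, both mixing times are past. -/
lemma tMix_tEnt_le {V : Type*} [Fintype V] [DecidableEq V] [Nontrivial V] {G : SimpleGraph V}
    [DecidableRel G.Adj] (hG : G.Connected) {ε t : ℝ} (hε : 0 < ε) (ht : 0 ≤ t)
    (h : ∀ x, relEntropy (transition (lampGen G) t x) (lampLaw G) ≤ min ε (ε ^ 2)) :
    tMix (lampGen G) (lampLaw G) ε ≤ t ∧ tEnt (lampGen G) (lampLaw G) ε ≤ t := by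
  have Hl := lamp_isIrreducibleReversible hG
  refine ⟨csInf_le ⟨0, fun s hs => hs.1⟩ ⟨ht, fun x => ?_⟩,
    csInf_le ⟨0, fun s hs => hs.1⟩ ⟨ht, fun x => (h x).trans (min_le_left _ _)⟩⟩
  refine (tvDist_le_sqrt_relEntropy (fun y => transition_nonneg Hl.rate_nonneg ht x y)
    (transition_row_sum Hl.row_sum t x) Hl.prob_pos Hl.prob_sum).trans ?_
  rw [← Real.sqrt_sq hε.le]
  exact Real.sqrt_le_sqrt ((h x).trans (min_le_right _ _))

open Filter in
/-- The asymptotics behind the comparison: at time `16 k³ n^(k+1) √n` the chain on the torus is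
mixed, while this time is negligible compared with `n^(k+2)`. -/
lemma eventually_torus_bounds (k : ℕ) {η : ℝ} (hη : 0 < η) (B : ℝ) : ∀ᶠ n : ℕ in atTop,
    ((n : ℝ) ^ k + 1) * (4 * k ^ 3 * n ^ (k + 1) * Real.exp (-√n)) ≤ η ∧ B * √n < n := by
  have hs : Tendsto (fun n : ℕ => √(n : ℝ)) atTop atTop :=
    Real.tendsto_sqrt_atTop.comp tendsto_natCast_atTop_atTop
  have h1 := ((Real.tendsto_pow_mul_exp_neg_atTop_nhds_zero (4 * k + 2)).const_mul
    (8 * (k : ℝ) ^ 3)).comp hs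
  rw [mul_zero] at h1
  filter_upwards [h1.eventually (gt_mem_nhds hη), hs.eventually_gt_atTop B, eventually_ge_atTop 1]
    with n hn hB hn1
  have hn1' : (1 : ℝ) ≤ n := by exact_mod_cast hn1
  have hsq : √(n : ℝ) ^ 2 = n := Real.sq_sqrt (Nat.cast_nonneg n)
  have hs0 : 0 < √(n : ℝ) := Real.sqrt_pos.2 (by linarith)
  constructor
  · refine le_trans ?_ hn.le
    simp only [Function.comp]
    have e : √(n : ℝ) ^ (4 * k + 2) = n ^ k * n ^ (k + 1) := by
      rw [show 4 * k + 2 = 2 * (k + (k + 1)) by ring, pow_mul, hsq, pow_add]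
    rw [e]
    have h2 : (n : ℝ) ^ k + 1 ≤ 2 * n ^ k := by
      have := one_le_pow₀ (n := k) hn1'
      linarith
    calc _ ≤ 2 * (n : ℝ) ^ k * (4 * k ^ 3 * n ^ (k + 1) * Real.exp (-√n)) :=
          mul_le_mul_of_nonneg_right h2 (by positivity)
      _ = _ := by ring
  · nlinarith

/-- On large tori the modified log-Sobolev constant exceeds any multiple of both mixing times. -/
lemma torus_mixing_lt_tMLS {k : ℕ} (hk : 1 ≤ k) {ε : ℝ} (hε : 0 < ε) (c : ℝ) :
    ∃ N : ℕ, 3 ≤ N ∧ ∀ (n : ℕ) [NeZero n], N ≤ n →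
      IsIrreducibleReversible (lampGen (torus k n)) (lampLaw (torus k n)) ∧
      c * tMix (lampGen (torus k n)) (lampLaw (torus k n)) ε
        < tMLS (lampGen (torus k n)) (lampLaw (torus k n)) ∧
      c * tEnt (lampGen (torus k n)) (lampLaw (torus k n)) ε
        < tMLS (lampGen (torus k n)) (lampLaw (torus k n)) := by
  have hk0 : (1 : ℝ) ≤ k := by exact_mod_cast hk
  obtain ⟨N, hN⟩ := Filter.eventually_atTop.1 (eventually_torus_bounds k
    (lt_min hε (pow_pos hε 2)) (|c| * (16 * k ^ 3) * (51200 * k)))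
  refine ⟨max 3 N, le_max_left _ _, fun n _ hn => ?_⟩
  have hn3 : 3 ≤ n := (le_max_left _ _).trans hn
  obtain ⟨hent, hlt⟩ := hN n ((le_max_right _ _).trans hn)
  have hn0 : (0 : ℝ) < n := by exact_mod_cast (by omega : 0 < n)
  have := torus_nontrivial hk hn3
  have hG := torus_connected (k := k) hn3
  set R : ℝ := 4 * k ^ 3 * n ^ (k + 1) with hR
  have hR0 : 0 < R := by positivity
  set t : ℝ := 4 * R * √n with ht
  have ht0 : 0 ≤ t := by positivity
  have hSR : ∑ x, ((torus k n).degree x : ℝ) ≤ R := by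
    refine torus_sum_degree_le.trans ?_
    have h1 : (1 : ℝ) ≤ n := by exact_mod_cast (by omega : 1 ≤ n)
    have h2 : (k : ℝ) ≤ k ^ 3 := le_self_pow₀ hk0 (by norm_num)
    have h3 : (n : ℝ) ^ k ≤ n ^ (k + 1) := pow_le_pow_right₀ h1 (by omega)
    calc (2 : ℝ) * k * n ^ k ≤ 4 * k ^ 3 * n ^ k :=
          mul_le_mul_of_nonneg_right (by nlinarith) (by positivity)
      _ ≤ _ := mul_le_mul_of_nonneg_left h3 (by positivity)
  have hmix : ∀ x, relEntropy (transition (lampGen (torus k n)) t x) (lampLaw (torus k n)) ≤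
      min ε (ε ^ 2) := by
    intro x
    refine (relEntropy_transition_le hG hSR (torus_resistance hk hn3) ht0 x).trans ?_
    have e : 1 / (4 * R) * t = √n := by
      rw [ht]
      field_simp
    rw [e, torus_card]
    push_cast
    exact hent
  obtain ⟨h1, h2⟩ := tMix_tEnt_le hG hε ht0 hmix
  have hmls : |c| * t < tMLS (lampGen (torus k n)) (lampLaw (torus k n)) := by
    refine lt_of_lt_of_le ?_ (tMLS_bounds hG torus_degree_le).1
    have hγ := gap_pos hG
    have hγ2 := torus_gap_le hk hn3
    rw [torus_card]
    push_cast
    have h3 : (n : ℝ) ^ k * n ^ 2 / 20 ≤ n ^ k / gap (torus k n) := by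
      rw [le_div_iff₀ hγ]
      calc _ ≤ (n : ℝ) ^ k * n ^ 2 / 20 * (20 / n ^ 2) :=
            mul_le_mul_of_nonneg_left hγ2 (by positivity)
        _ = _ := by field_simp
    refine lt_of_lt_of_le ?_ (mul_le_mul_of_nonneg_left h3 (by positivity))
    have e1 : 1 / (1280 * (2 * (k : ℝ))) * ((n : ℝ) ^ k * n ^ 2 / 20) =
        n ^ (k + 1) * n / (51200 * k) := by
      field_simp
      ring
    rw [e1, lt_div_iff₀ (by positivity)]
    calc |c| * t * (51200 * k) = n ^ (k + 1) * (|c| * (16 * k ^ 3) * (51200 * k) * √n) := by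
          rw [ht, hR]
          ring
      _ < _ := mul_lt_mul_of_pos_left hlt (by positivity)
  have hnn1 : 0 ≤ tMix (lampGen (torus k n)) (lampLaw (torus k n)) ε :=
    Real.sInf_nonneg fun s hs => hs.1
  have hnn2 : 0 ≤ tEnt (lampGen (torus k n)) (lampLaw (torus k n)) ε :=
    Real.sInf_nonneg fun s hs => hs.1
  have hc := le_abs_self c
  refine ⟨lamp_isIrreducibleReversible hG, lt_of_le_of_lt ?_ hmls, lt_of_le_of_lt ?_ hmls⟩
  · exact (mul_le_mul_of_nonneg_right hc hnn1).trans
      (mul_le_mul_of_nonneg_left h1 (abs_nonneg c))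
  · exact (mul_le_mul_of_nonneg_right hc hnn2).trans
      (mul_le_mul_of_nonneg_left h2 (abs_nonneg c))

end Lamplighter

open MarkovChain Lamplighter in
theorem corollary3 :
    (∀ d : ℕ, ∃ c C : ℝ, 0 < c ∧ 0 < C ∧
      ∀ (V : Type*) [Fintype V] [DecidableEq V] [Nontrivial V]
        (G : SimpleGraph V) [DecidableRel G.Adj], G.Connected → G.maxDegree = d →
        IsIrreducibleReversible (lampGen G) (lampLaw G) ∧
        0 < gap G ∧
        c * ((Fintype.card V : ℝ) / gap G) ≤ tMLS (lampGen G) (lampLaw G) ∧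
        tMLS (lampGen G) (lampLaw G) ≤ C * ((Fintype.card V : ℝ) / gap G)) ∧
    (∀ k : ℕ, 1 ≤ k → ∀ ε : ℝ, 0 < ε → ∀ c : ℝ, ∃ N : ℕ, 3 ≤ N ∧
      ∀ (n : ℕ) [NeZero n], N ≤ n →
        IsIrreducibleReversible (lampGen (torus k n)) (lampLaw (torus k n)) ∧
        c * tMix (lampGen (torus k n)) (lampLaw (torus k n)) ε
          < tMLS (lampGen (torus k n)) (lampLaw (torus k n)) ∧
        c * tEnt (lampGen (torus k n)) (lampLaw (torus k n)) ε
          < tMLS (lampGen (torus k n)) (lampLaw (torus k n))) := by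
  refine ⟨fun d => ?_, fun k hk ε hε c => torus_mixing_lt_tMLS hk hε c⟩
  rcases Nat.eq_zero_or_pos d with rfl | hd
  · -- a connected graph with at least two vertices has an edge
    refine ⟨1, 1, one_pos, one_pos, fun V _ _ _ G _ hG hd => ?_⟩
    obtain ⟨i⟩ : Nonempty V := inferInstance
    have h1 := hG.preconnected.degree_pos_of_nontrivial i
    have h2 := G.degree_le_maxDegree i
    omega
  · have hd' : (0 : ℝ) < d := by exact_mod_cast hd
    refine ⟨1 / (1280 * d), 16 * d, by positivity, by positivity, fun V _ _ _ G _ hG hmax => ?_⟩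
    obtain ⟨h1, h2⟩ := tMLS_bounds hG (D := d) fun i => hmax ▸ G.degree_le_maxDegree i
    exact ⟨lamp_isIrreducibleReversible hG, gap_pos hG, h1, h2⟩
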